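/- Let $p>3$ be a prime and let $\mathrm{SL}_2(\mathbb F_p)$ act on $M=\mathbb F_p[X,Y]$ by $(gP)(X,Y)=P(aX+cY,\,bX+dY)$ for $g=\begin{pmatrix}a&b\\c&d\end{pmatrix}$. Put $$f_1=X^pY-XY^p,\qquad f_2=\frac{X^{p^2-1}-Y^{p^2-1}}{X^{p-1}-Y^{p-1}}=\sum_{i=0}^{p}X^{i(p-1)}Y^{(p-i)(p-1)}.$$ Let $A=M^{\mathrm{SL}_2(\mathbb F_p)}$ be the ring of invariants, and let $M_{\mathrm{SL}_2(\mathbb F_p)}=M/I M$ be the coinvariants, where $IM$ is the span of all $gP-P$ with $g\in \mathrm{SL}_2(\mathbb F_p)$, $P\in M$; it is a module over $A$. Then $f_1,f_2$ are algebraically independent over $\mathbb F_p$ and $A=\mathbb F_p[f_1,f_2]$. As an $A$-module, $M_{\mathrm{SL}_2(\mathbb F_p)}$ is the internal direct sum of the cyclic submodules generated by the classes of the indicated monomials, $$M_{\mathrm{SL}_2(\mathbb F_p)}=A\cdot X^{p^2-p}Y^{p-1}\;\oplus\;\bigoplus_{k=2}^{p-1}A\cdot X^{(k-1)(p-1)}Y^{p-1}\;\oplus\;A\cdot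 1,$$ where 1. $A\cdot X^{p^2-p}Y^{p-1}$ is free of rank one over $A$, with the class of $X^{p^2-p}Y^{p-1}$ as a basis; 2. each $A\cdot X^{(k-1)(p-1)}Y^{p-1}$ $(2\le k\le p-1)$ and $A\cdot 1$ is annihilated by $f_1$ and is free of rank one over $A/(f_1)$, with the indicated generator as a basis. Moreover, with $\epsilon_{p-1}^{n}=Y(Y-X)(Y-2X)\cdots(Y-(p-2)X)\,X^{n-p+1}$, the class of $X^{p^2-p}Y^{p-1}$ in $M_{\mathrm{SL}_2(\mathbb F_p)}$ equals that of $\epsilon_{p-1}^{p^2-1}$, and the class of $X^{(k-1)(p-1)}Y^{p-1}$ equals that of $\epsilon_{p-1}^{k(p-1)}$ for $2\le k\le p-1$. -/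

import Mathlib

namespace ModPCoinvariants

noncomputable section

/-- The polynomial ring `F_p[X, Y]`; the variable `0` is `X` and the variable `1` is `Y`. -/
abbrev Poly (p : ℕ) : Type := MvPolynomial (Fin 2) (ZMod p)

/-- The variable `X`. -/
abbrev vX (p : ℕ) : Poly p := MvPolynomial.X 0

/-- The variable `Y`. -/
abbrev vY (p : ℕ) : Poly p := MvPolynomial.X 1

/-- The group `SL_2(F_p)`. -/
abbrev SL2 (p : ℕ) : Type := Matrix.SpecialLinearGroup (Fin 2) (ZMod p)

/-- The substitution `P(X, Y) ↦ P(aX + cY, bX + dY)` attached to a matrix with rows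
`(a, b)` and `(c, d)`. -/
def subst (p : ℕ) (g : SL2 p) : Poly p →ₐ[ZMod p] Poly p :=
  MvPolynomial.aeval
    ![MvPolynomial.C (g.1 0 0) * vX p + MvPolynomial.C (g.1 1 0) * vY p,
      MvPolynomial.C (g.1 0 1) * vX p + MvPolynomial.C (g.1 1 1) * vY p]

theorem subst_X (p : ℕ) (g : SL2 p) :
    subst p g (vX p)
      = MvPolynomial.C (g.1 0 0) * vX p + MvPolynomial.C (g.1 1 0) * vY p := by
  simp [subst]

theorem subst_Y (p : ℕ) (g : SL2 p) :
    subst p g (vY p)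
      = MvPolynomial.C (g.1 0 1) * vX p + MvPolynomial.C (g.1 1 1) * vY p := by
  simp [subst]

theorem subst_C (p : ℕ) (g : SL2 p) (a : ZMod p) :
    subst p g (MvPolynomial.C a) = MvPolynomial.C a := by
  simp [subst]

theorem subst_one (p : ℕ) : subst p 1 = AlgHom.id (ZMod p) (Poly p) := by
  apply MvPolynomial.algHom_ext
  intro i
  fin_cases i
  · simpa using subst_X p 1
  · simpa using subst_Y p 1

theorem subst_mul (p : ℕ) (g h : SL2 p) : subst p (g * h) = (subst p g).comp (subst p h) := by
  apply MvPolynomial.algHom_ext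
  intro i
  fin_cases i
  · change subst p (g * h) (vX p) = subst p g (subst p h (vX p))
    rw [subst_X, subst_X]
    simp only [map_add, map_mul, subst_X, subst_Y, subst_C, Matrix.SpecialLinearGroup.coe_mul,
      Matrix.mul_apply, Fin.sum_univ_two]
    ring
  · change subst p (g * h) (vY p) = subst p g (subst p h (vY p))
    rw [subst_Y, subst_Y]
    simp only [map_add, map_mul, subst_X, subst_Y, subst_C, Matrix.SpecialLinearGroup.coe_mul,
      Matrix.mul_apply, Fin.sum_univ_two]
    ring

/-- The representation of `SL_2(F_p)` on `F_p[X, Y]`, `(g P)(X, Y) = P(aX + cY, bX + dY)`. -/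
def rho (p : ℕ) : Representation (ZMod p) (SL2 p) (Poly p) where
  toFun g := (subst p g).toLinearMap
  map_one' := by rw [subst_one]; rfl
  map_mul' g h := by rw [subst_mul]; rfl

/-- The ring of invariants `A = F_p[X, Y]^{SL_2(F_p)}`. -/
def Inv (p : ℕ) : Subalgebra (ZMod p) (Poly p) where
  carrier := {P | ∀ g : SL2 p, rho p g P = P}
  mul_mem' := by
    intro P Q hP hQ g
    have h1 : subst p g P = P := hP g
    have h2 : subst p g Q = Q := hQ g
    change subst p g (P * Q) = P * Q
    rw [map_mul, h1, h2]
  add_mem' := by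
    intro P Q hP hQ g
    rw [map_add, hP g, hQ g]
  algebraMap_mem' := by
    intro a g
    exact subst_C p g a

/-- The ring structure of the invariants. -/
instance instCommRingInv (p : ℕ) : CommRing (Inv p) := (Inv p).toCommRing

/-- The polynomial ring is a module over the invariants. -/
instance instModulePoly (p : ℕ) : Module (Inv p) (Poly p) := (Inv p).module

/-- The submodule `I_G M` of `M = F_p[X, Y]` spanned by all `g P - P`. It is an `A`-submodule,
because `a (g P - P) = g (a P) - a P` for an invariant `a`. -/
def augSubmodule (p : ℕ) : Submodule (Inv p) (Poly p) where
  carrier := {P | P ∈ Representation.Coinvariants.ker (rho p)}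
  zero_mem' := Submodule.zero_mem (Representation.Coinvariants.ker (rho p))
  add_mem' := fun hP hQ => Submodule.add_mem (Representation.Coinvariants.ker (rho p)) hP hQ
  smul_mem' := by
    intro a P hP
    change P ∈ Submodule.span _ _ at hP
    change a • P ∈ Submodule.span _ _
    induction hP using Submodule.span_induction with
    | mem x hx =>
      obtain ⟨⟨g, Q⟩, rfl⟩ := hx
      apply Submodule.subset_span
      refine ⟨(g, a.1 * Q), ?_⟩
      have ha : subst p g a.1 = a.1 := a.2 g
      change subst p g (a.1 * Q) - a.1 * Q = a.1 * (subst p g Q - Q)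
      rw [map_mul, ha]
      ring
    | zero => rw [smul_zero]; exact Submodule.zero_mem _
    | add x y _ _ hx hy => rw [smul_add]; exact Submodule.add_mem _ hx hy
    | smul c x _ hx => rw [smul_comm]; exact Submodule.smul_mem _ c hx

/-- The coinvariants `F_p[X, Y]_{SL_2(F_p)} = M / I_G M`, as an `A`-module. -/
def Coinv (p : ℕ) : Type := Poly p ⧸ augSubmodule p

/-- The additive group structure of the coinvariants. -/
instance instAddCommGroupCoinv (p : ℕ) : AddCommGroup (Coinv p) :=
  Submodule.Quotient.addCommGroup (augSubmodule p)

/-- The `A`-module structure of the coinvariants. -/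
instance instModuleCoinv (p : ℕ) : Module (Inv p) (Coinv p) :=
  Submodule.Quotient.module (augSubmodule p)

/-- The class of a polynomial in the coinvariants. -/
def cls (p : ℕ) (P : Poly p) : Coinv p := (augSubmodule p).mkQ P

/-- `f_1 = X^p Y - X Y^p`. -/
def f1 (p : ℕ) : Poly p := vX p ^ p * vY p - vX p * vY p ^ p

/-- `f_2 = (X^(p^2-1) - Y^(p^2-1)) / (X^(p-1) - Y^(p-1))`, with the quotient written out as
`∑_{i=0}^{p} X^(i(p-1)) Y^((p-i)(p-1))`. -/
def f2 (p : ℕ) : Poly p :=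
  ∑ i ∈ Finset.range (p + 1), vX p ^ (i * (p - 1)) * vY p ^ ((p - i) * (p - 1))

theorem f2_mul (p : ℕ) :
    f2 p * (vX p ^ (p - 1) - vY p ^ (p - 1)) = vX p ^ (p ^ 2 - 1) - vY p ^ (p ^ 2 - 1) := by
  have h := (Commute.all (vX p ^ (p - 1)) (vY p ^ (p - 1))).geom_sum₂_mul (p + 1)
  have e : (p - 1) * (p + 1) = p ^ 2 - 1 := by
    rw [mul_comm]
    simpa using (Nat.sq_sub_sq p 1).symm
  rw [← pow_mul, ← pow_mul, e] at h
  rw [← h, f2]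
  congr 1
  apply Finset.sum_congr rfl
  intro i _
  rw [← pow_mul, ← pow_mul, mul_comm i, mul_comm (p - i), Nat.add_sub_cancel]

theorem f1_mem (p : ℕ) [Fact p.Prime] : f1 p ∈ Inv p := by
  intro g
  change subst p g (f1 p) = f1 p
  have hdet : g.1 0 0 * g.1 1 1 - g.1 0 1 * g.1 1 0 = 1 := by
    rw [← Matrix.det_fin_two]; exact g.2
  have hC : (MvPolynomial.C (g.1 0 0) * MvPolynomial.C (g.1 1 1)
      - MvPolynomial.C (g.1 0 1) * MvPolynomial.C (g.1 1 0) : Poly p) = 1 := by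
    rw [← MvPolynomial.C_mul, ← MvPolynomial.C_mul, ← MvPolynomial.C_sub, hdet, MvPolynomial.C_1]
  simp only [f1, map_sub, map_mul, map_pow, subst_X, subst_Y, add_pow_char, mul_pow,
    ← MvPolynomial.C_pow, ZMod.pow_card]
  linear_combination (vX p ^ p * vY p - vX p * vY p ^ p) * hC

/-- `f_1` as an element of the ring of invariants. -/
def f1Inv (p : ℕ) [Fact p.Prime] : Inv p := ⟨f1 p, f1_mem p⟩

/-- The quotient ring `A / (f_1)`. -/
abbrev InvModF1 (p : ℕ) [Fact p.Prime] : Type := Inv p ⧸ Ideal.span {f1Inv p}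

/-- The `A`-module structure of `A / (f_1)`. -/
instance instModuleInvModF1 (p : ℕ) [Fact p.Prime] : Module (Inv p) (InvModF1 p) :=
  Submodule.Quotient.module (Ideal.span {f1Inv p})

/-- The indices of the summands: one for `X^(p^2-p) Y^(p-1)`, one for every `2 ≤ k ≤ p - 1`,
and one for `1`. -/
abbrev Idx (p : ℕ) : Type := Unit ⊕ {k : ℕ // k ∈ Finset.Icc 2 (p - 1)} ⊕ Unit

/-- The class of `X^(p^2-p) Y^(p-1)` in the coinvariants. -/
def topGen (p : ℕ) : Coinv p := cls p (vX p ^ (p ^ 2 - p) * vY p ^ (p - 1))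

/-- The class of `X^((k-1)(p-1)) Y^(p-1)` in the coinvariants. -/
def midGen (p k : ℕ) : Coinv p := cls p (vX p ^ ((k - 1) * (p - 1)) * vY p ^ (p - 1))

/-- The class of `1` in the coinvariants. -/
def oneGen (p : ℕ) : Coinv p := cls p 1

/-- The generators of all the summands. -/
def gen (p : ℕ) : Idx p → Coinv p :=
  Sum.elim (fun _ => topGen p) (Sum.elim (fun k => midGen p k.1) (fun _ => oneGen p))

/-- `ε_k^n = Y (Y - X) ⋯ (Y - (k-1) X) X^(n-k)`, a form of degree `n` for `k ≤ n`. -/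
def eps (p k n : ℕ) : Poly p :=
  (∏ i ∈ Finset.range k, (vY p - (i : Poly p) * vX p)) * vX p ^ (n - k)

end

end ModPCoinvariants

namespace ModPCoinvariants

noncomputable section

open MvPolynomial Representation.Coinvariants

/-! Write N for `nY`, so that f_1 = -XN and f_2 = N^(p-1) + X^(p(p-1)).

Invariants: restriction to the line X = 0 (`psi`) sends A into the polynomials in Y^(p(p-1))
(`dvd_of_coeff_psi_ne_zero`), which are the restrictions of polynomials in f_2. Its kernel on A is
f_1 A (`f1_dvd_of_psi_eq_zero`), so Dickson's theorem follows by induction on the degree.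

Generation: the products X^i N^j Y^k with k < p span M. If c is fixed by Y ↦ X + Y, then cXY^b dies
in the coinvariants for b + 1 < p (`mul_X_mul_Y_pow_mem`), and the torus kills every product of
nonzero weight. What survives, N^j Y^k and X^i N^j Y^(p-1), is brought to the generators by f_1, f_2
and the congruence N^(k-1) Y^(p-k) ≡ -X^((k-1)(p-1)) Y^(p-1) (`nY_pow_mul_Y_pow_add_mem`). The same
congruence gives the f_1-torsion.

Independence: two maps factor through the coinvariants. `transfer` is A-linear into a domain, so it
kills f_1-torsion, and it is nonzero on the top generator. `lineSum` is linear along `psi` and sends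
the torsion generators to nonzero multiples of T^(d(p-1)) with distinct d < p; as `psi` of an
invariant only involves exponents divisible by p(p-1), their multiples cannot cancel. -/

/-! ### Group elements, and f_1, f_2 in terms of N -/

/-- The form `Y^p - X^(p-1) Y`, which is the product of all `Y - c X` with `c` in `F_p`. -/
def nY (p : ℕ) : Poly p := vY p ^ p - vX p ^ (p - 1) * vY p

/-- The unipotent matrix fixing `X` and sending `Y` to `X + Y`. -/
def unip (p : ℕ) : SL2 p := ⟨!![1, 1; 0, 1], by simp⟩

/-- The matrix sending `X` to `Y` and `Y` to `-X`. -/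
def weyl (p : ℕ) : SL2 p := ⟨!![0, -1; 1, 0], by simp⟩

/-- The matrix sending `X` to `u X` and `Y` to `u⁻¹ Y`. -/
def torus (p : ℕ) (u : (ZMod p)ˣ) : SL2 p := ⟨!![(u : ZMod p), 0; 0, (u⁻¹ : (ZMod p)ˣ)], by simp⟩

/-- A matrix sending `X` to `c X + Y`. -/
def slant (p : ℕ) (c : ZMod p) : SL2 p := ⟨!![c, -1; 1, 0], by simp⟩

@[simp] theorem unip_X (p : ℕ) : subst p (unip p) (vX p) = vX p := by
  rw [subst_X]; simp [unip]

@[simp] theorem unip_Y (p : ℕ) : subst p (unip p) (vY p) = vX p + vY p := by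
  rw [subst_Y]; simp [unip]

@[simp] theorem weyl_X (p : ℕ) : subst p (weyl p) (vX p) = vY p := by
  rw [subst_X]; simp [weyl]

@[simp] theorem torus_X (p : ℕ) (u : (ZMod p)ˣ) :
    subst p (torus p u) (vX p) = C (u : ZMod p) * vX p := by
  rw [subst_X]; simp [torus]

@[simp] theorem torus_Y (p : ℕ) (u : (ZMod p)ˣ) :
    subst p (torus p u) (vY p) = C ((u⁻¹ : (ZMod p)ˣ) : ZMod p) * vY p := by
  rw [subst_Y]; simp [torus]

theorem slant_X (p : ℕ) (c : ZMod p) : subst p (slant p c) (vX p) = C c * vX p + vY p := by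
  rw [subst_X]; simp [slant]

theorem mem_Inv_iff {p : ℕ} {P : Poly p} : P ∈ Inv p ↔ ∀ g, subst p g P = P := Iff.rfl

theorem f1_eq (p : ℕ) [Fact p.Prime] : f1 p = -(vX p * nY p) := by
  have hp := (Fact.out : p.Prime).pos
  have : vX p ^ p = vX p ^ (p - 1) * vX p := by
    rw [← pow_succ]; congr 1; omega
  rw [f1, nY, this]; ring

theorem f1_ne_zero (p : ℕ) [Fact p.Prime] : f1 p ≠ 0 := by
  intro h
  have h2 := congrArg (fun P => P.coeff (Finsupp.single 0 p + Finsupp.single 1 1)) h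
  have hp := (Fact.out : p.Prime).one_lt
  have e1 : f1 p = monomial (Finsupp.single 0 p + Finsupp.single 1 1) 1
      - monomial (Finsupp.single 0 1 + Finsupp.single 1 p) 1 := by
    simp only [f1, vX, vY, MvPolynomial.X, monomial_pow, monomial_mul]
    simp
  rw [e1] at h2
  simp only [coeff_sub, coeff_monomial, coeff_zero, if_true] at h2
  rw [if_neg] at h2
  · simp at h2
  · intro h3
    have := DFunLike.congr_fun h3 0
    simp at this
    omega

theorem f2_eq (p : ℕ) [Fact p.Prime] : f2 p = nY p ^ (p - 1) + vX p ^ (p * (p - 1)) := by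
  have hp := (Fact.out : p.Prime).one_lt
  have hne : vX p ^ (p - 1) - vY p ^ (p - 1) ≠ 0 := by
    intro h
    apply f1_ne_zero p
    have h1 : vX p ^ p = vX p ^ (p - 1) * vX p := by rw [← pow_succ]; congr 1; omega
    have h2 : vY p ^ p = vY p ^ (p - 1) * vY p := by rw [← pow_succ]; congr 1; omega
    rw [f1, h1, h2]
    linear_combination vX p * vY p * h
  apply mul_right_cancel₀ hne
  rw [f2_mul]
  have e : p ^ 2 - 1 = (p - 1) * p + (p - 1) := by
    obtain ⟨q, rfl⟩ : ∃ q, p = q + 1 := ⟨p - 1, by omega⟩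
    simp; ring_nf; omega
  have hN : nY p = vY p * (vY p ^ (p - 1) - vX p ^ (p - 1)) := by
    have h2 : vY p ^ p = vY p ^ (p - 1) * vY p := by rw [← pow_succ]; congr 1; omega
    rw [nY, h2]; ring
  have hN2 : (vY p ^ (p - 1) - vX p ^ (p - 1)) ^ (p - 1) * (vY p ^ (p - 1) - vX p ^ (p - 1))
      = (vY p ^ (p - 1)) ^ p - (vX p ^ (p - 1)) ^ p := by
    rw [← pow_succ, show p - 1 + 1 = p by omega, sub_pow_char]
  rw [hN, mul_pow, e, pow_add, pow_add, pow_mul, pow_mul, mul_comm p (p - 1), pow_mul]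
  linear_combination vY p ^ (p - 1) * hN2

/-- The product f_1 f_2 = X^(p^2) Y - X Y^(p^2) is a determinant with rows (X, Y) and its Frobenius
twist, hence is multiplied by det g = 1; then f_1 is cancelled. -/
theorem f2_mem (p : ℕ) [Fact p.Prime] : f2 p ∈ Inv p := by
  have hp := (Fact.out : p.Prime).one_lt
  have h12 : f1 p * f2 p = vX p ^ (p ^ 2) * vY p - vX p * vY p ^ (p ^ 2) := by
    have h1 : vX p ^ p = vX p ^ (p - 1) * vX p := by rw [← pow_succ]; congr 1; omega
    have h2 : vY p ^ p = vY p ^ (p - 1) * vY p := by rw [← pow_succ]; congr 1; omega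
    have hq : 0 < p ^ 2 := by positivity
    have h3 : vX p ^ (p ^ 2) = vX p ^ (p ^ 2 - 1) * vX p := by rw [← pow_succ]; congr 1; omega
    have h4 : vY p ^ (p ^ 2) = vY p ^ (p ^ 2 - 1) * vY p := by rw [← pow_succ]; congr 1; omega
    rw [f1, h1, h2, h3, h4]
    linear_combination vX p * vY p * f2_mul p
  intro g
  change subst p g (f2 p) = f2 p
  have hg : subst p g (f1 p) = f1 p := f1_mem p g
  apply mul_left_cancel₀ (f1_ne_zero p)
  rw [h12]
  nth_rw 1 [← hg]
  rw [← map_mul, h12]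
  have hdet : g.1 0 0 * g.1 1 1 - g.1 0 1 * g.1 1 0 = 1 := by
    rw [← Matrix.det_fin_two]; exact g.2
  have hC : (C (g.1 0 0) * C (g.1 1 1) - C (g.1 0 1) * C (g.1 1 0) : Poly p) = 1 := by
    rw [← C_mul, ← C_mul, ← C_sub, hdet, C_1]
  simp only [map_sub, map_mul, map_pow, subst_X, subst_Y, add_pow_char_pow, mul_pow,
    ← C_pow, ZMod.pow_card_pow]
  linear_combination (vX p ^ p ^ 2 * vY p - vX p * vY p ^ p ^ 2) * hC

/-! ### Dickson's theorem by restriction to X = 0 -/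

/-- Restriction of a polynomial to the line `X = 0`. -/
def psi (p : ℕ) : Poly p →ₐ[ZMod p] Polynomial (ZMod p) := aeval ![0, Polynomial.X]

@[simp] theorem psi_X (p : ℕ) : psi p (vX p) = 0 := by simp [psi]

@[simp] theorem psi_Y (p : ℕ) : psi p (vY p) = Polynomial.X := by simp [psi]

theorem psi_f1 (p : ℕ) [Fact p.Prime] : psi p (f1 p) = 0 := by simp [f1_eq]

theorem psi_f2 (p : ℕ) [Fact p.Prime] : psi p (f2 p) = Polynomial.X ^ (p * (p - 1)) := by
  have hp := (Fact.out : p.Prime).one_lt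
  have h : p - 1 ≠ 0 := by omega
  have h' : p ≠ 0 := by omega
  simp [f2_eq, nY, h, h', ← pow_mul]

/-- Reduction modulo X factors through `psi`. -/
theorem X_dvd_of_psi_eq_zero {p : ℕ} {P : Poly p} (h : psi p P = 0) : vX p ∣ P := by
  have key : (Ideal.Quotient.mkₐ (ZMod p) (Ideal.span {vX p})) =
      (((Ideal.Quotient.mkₐ (ZMod p) (Ideal.span {vX p})).comp
        (Polynomial.aeval (vY p))).comp (psi p)) := by
    apply MvPolynomial.algHom_ext
    intro i
    fin_cases i
    · change Ideal.Quotient.mk _ (vX p) = Ideal.Quotient.mk _ (Polynomial.aeval (vY p) (psi p (vX p)))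
      rw [psi_X, map_zero, map_zero, Ideal.Quotient.eq_zero_iff_mem]
      exact Ideal.mem_span_singleton_self _
    · change Ideal.Quotient.mk _ (vY p) = Ideal.Quotient.mk _ (Polynomial.aeval (vY p) (psi p (vY p)))
      rw [psi_Y, Polynomial.aeval_X]
  have h2 := DFunLike.congr_fun key P
  simp only [AlgHom.comp_apply, h, map_zero] at h2
  exact Ideal.mem_span_singleton.1 (Ideal.Quotient.eq_zero_iff_mem.1 h2)

theorem psi_pderiv {p : ℕ} (P : Poly p) :
    psi p (pderiv 1 P) = Polynomial.derivative (psi p P) := by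
  induction P using MvPolynomial.induction_on with
  | C a => simp [psi]
  | add P Q hP hQ => simp [hP, hQ]
  | mul_X P i hP =>
    rw [Derivation.leibniz, map_mul, Polynomial.derivative_mul, map_add, smul_eq_mul, smul_eq_mul,
      map_mul, map_mul, hP]
    fin_cases i
    · simp [pderiv_X]
    · simp [pderiv_X, mul_comm, add_comm]

/-- First-order Taylor expansion of P(X, Y + X) in the increment X. For an invariant P it forces X
to divide ∂P/∂Y. -/
theorem X_sq_dvd_unip_sub {p : ℕ} (P : Poly p) :
    vX p ^ 2 ∣ subst p (unip p) P - P - vX p * pderiv 1 P := by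
  induction P using MvPolynomial.induction_on with
  | C a => simp
  | add P Q hP hQ =>
    convert dvd_add hP hQ using 1
    simp only [map_add]; ring
  | mul_X P i hP =>
    rw [Derivation.leibniz, map_mul, smul_eq_mul, smul_eq_mul]
    obtain ⟨R, hR⟩ := hP
    fin_cases i
    · refine ⟨R * vX p, ?_⟩
      simp [pderiv_X]
      linear_combination vX p * hR
    · refine ⟨R * (vX p + vY p) + pderiv 1 P, ?_⟩
      simp [pderiv_X]
      linear_combination (vX p + vY p) * hR

theorem psi_torus {p : ℕ} (u : (ZMod p)ˣ) (P : Poly p) :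
    psi p (subst p (torus p u) P)
      = (psi p P).comp (Polynomial.C ((u⁻¹ : (ZMod p)ˣ) : ZMod p) * Polynomial.X) := by
  induction P using MvPolynomial.induction_on with
  | C a => simp [psi]
  | add P Q hP hQ => simp [hP, hQ]
  | mul_X P i hP =>
    rw [map_mul, map_mul, map_mul, Polynomial.mul_comp, hP]
    fin_cases i
    · simp
    · simp [psi]

/-- The unipotent element makes the derivative of `psi p P` vanish, so p divides n; the torus gives
u^n = 1 for every unit u, so p - 1 divides n. -/
theorem dvd_of_coeff_psi_ne_zero {p : ℕ} [Fact p.Prime] {P : Poly p} (hP : P ∈ Inv p) {n : ℕ}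
    (hn : (psi p P).coeff n ≠ 0) : p * (p - 1) ∣ n := by
  have hp := (Fact.out : p.Prime).one_lt
  apply Nat.Coprime.mul_dvd_of_dvd_of_dvd
  · rw [Nat.coprime_comm]
    exact Nat.Coprime.symm (((Fact.out : p.Prime).coprime_iff_not_dvd).2
      fun h => by have := Nat.le_of_dvd (by omega) h; omega)
  · have h1 := X_sq_dvd_unip_sub P
    rw [mem_Inv_iff.1 hP, sub_self, zero_sub, dvd_neg, sq] at h1
    have h2 : vX p ∣ pderiv 1 P := (mul_dvd_mul_iff_left (X_ne_zero _)).1 h1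
    obtain ⟨R, hR⟩ := h2
    have h3 := psi_pderiv P
    rw [hR, map_mul, psi_X, zero_mul] at h3
    rcases n with _ | n
    · simp
    have h4 := congrArg (fun Q => Q.coeff n) h3
    simp only [Polynomial.coeff_zero, Polynomial.coeff_derivative] at h4
    rcases mul_eq_zero.1 h4.symm with h5 | h5
    · exact absurd h5 hn
    · rw [← ZMod.natCast_eq_zero_iff]; exact_mod_cast h5
  · have := FiniteField.forall_pow_eq_one_iff (ZMod p) n
    rw [ZMod.card] at this
    rw [← this]
    intro u
    have h1 := psi_torus u⁻¹ P
    rw [mem_Inv_iff.1 hP] at h1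
    have h2 := congrArg (fun Q => Q.coeff n) h1
    simp only [Polynomial.comp_C_mul_X_coeff, inv_inv] at h2
    have h3 : (u : ZMod p) ^ n = 1 := by
      apply mul_left_cancel₀ hn
      rw [mul_one, ← h2]
    exact Units.ext (by simpa using h3)

theorem prod_add_algebraMap_eq {p : ℕ} [Fact p.Prime] {K : Type*} [Field K] [Algebra (ZMod p) K]
    (z : K) : ∏ c : ZMod p, (algebraMap (ZMod p) K c + z) = z ^ p - z := by
  have hp := (Fact.out : p.Prime).one_lt
  have hmon : (Polynomial.X ^ p - Polynomial.X : Polynomial (ZMod p)).Monic :=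
    Polynomial.monic_X_pow_sub (by rw [Polynomial.degree_X]; exact_mod_cast hp)
  have hroots := FiniteField.roots_X_pow_card_sub_X (ZMod p)
  rw [ZMod.card] at hroots
  have h := Polynomial.prod_multiset_X_sub_C_of_monic_of_roots_card_eq hmon (by
    rw [hroots, FiniteField.X_pow_card_sub_X_natDegree_eq _ hp]
    simp [ZMod.card])
  rw [hroots] at h
  have h2 := congrArg (Polynomial.aeval z) h
  change Polynomial.aeval z (∏ c : ZMod p, (Polynomial.X - Polynomial.C c)) = _ at h2
  simp only [map_prod, map_sub, map_pow, Polynomial.aeval_X, Polynomial.aeval_C] at h2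
  rw [← h2]
  exact Fintype.prod_equiv (Equiv.neg _) _ _ fun c => by simp [add_comm]

theorem prod_mul_add_eq {p : ℕ} [Fact p.Prime] {K : Type*} [Field K] [Algebra (ZMod p) K]
    {x : K} (hx : x ≠ 0) (y : K) :
    ∏ c : ZMod p, (algebraMap (ZMod p) K c * x + y) = y ^ p - x ^ (p - 1) * y := by
  have h3 : ∀ c : ZMod p, algebraMap (ZMod p) K c * x + y
      = x * (algebraMap (ZMod p) K c + y / x) := fun c => by
    field_simp
  simp only [h3, Finset.prod_mul_distrib, prod_add_algebraMap_eq, Finset.prod_const,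
    Finset.card_univ, ZMod.card]
  rw [mul_sub, div_pow, mul_div_cancel₀ _ (pow_ne_zero _ hx)]
  have h1 : x ^ p = x ^ (p - 1) * x := by
    rw [← pow_succ]; congr 1; have := (Fact.out : p.Prime).pos; omega
  rw [h1]
  field_simp

/-- In the fraction field one may divide by X, reducing to the factorization of z^p - z at z = Y/X.
-/
theorem nY_eq_prod (p : ℕ) [Fact p.Prime] : nY p = ∏ c : ZMod p, (C c * vX p + vY p) := by
  apply FaithfulSMul.algebraMap_injective (Poly p) (FractionRing (Poly p))
  have hx : algebraMap (Poly p) (FractionRing (Poly p)) (vX p) ≠ 0 := by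
    rw [Ne, FaithfulSMul.algebraMap_eq_zero_iff]
    exact X_ne_zero _
  have hC : ∀ c : ZMod p, algebraMap (Poly p) (FractionRing (Poly p)) (C c)
      = algebraMap (ZMod p) (FractionRing (Poly p)) c := fun c =>
    (IsScalarTower.algebraMap_apply (ZMod p) (Poly p) (FractionRing (Poly p)) c).symm
  simp only [nY, map_prod, map_add, map_mul, map_sub, map_pow, hC]
  rw [prod_mul_add_eq hx]

/-- The substitution attached to a group element, as an automorphism. -/
def substEquiv (p : ℕ) (g : SL2 p) : Poly p ≃ₐ[ZMod p] Poly p :=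
  AlgEquiv.ofAlgHom (subst p g) (subst p g⁻¹)
    (by rw [← subst_mul, mul_inv_cancel, subst_one])
    (by rw [← subst_mul, inv_mul_cancel, subst_one])

theorem not_vX_dvd_vY {p : ℕ} [Fact p.Prime] : ¬ vX p ∣ vY p := by
  rintro ⟨R, hR⟩
  have := congrArg (psi p) hR
  rw [map_mul, psi_X, zero_mul, psi_Y] at this
  exact Polynomial.X_ne_zero this

theorem isRelPrime_vX_slant {p : ℕ} [Fact p.Prime] (c : ZMod p) :
    IsRelPrime (vX p) (C c * vX p + vY p) := by
  rw [Irreducible.isRelPrime_iff_not_dvd (X_prime).irreducible]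
  intro h
  exact not_vX_dvd_vY ((dvd_add_right (Dvd.intro_left _ rfl)).1 h)

theorem isRelPrime_slant {p : ℕ} [Fact p.Prime] {c d : ZMod p} (h : c ≠ d) :
    IsRelPrime (C c * vX p + vY p) (C d * vX p + vY p) := by
  intro Q h1 h2
  have h3 : Q ∣ C (c - d) * vX p := by
    convert dvd_sub h1 h2 using 1
    rw [C_sub]; ring
  have hu : IsUnit (C (c - d) : Poly p) := (isUnit_iff_ne_zero.2 (sub_ne_zero.2 h)).map C
  exact isRelPrime_vX_slant c (hu.dvd_mul_left.1 h3) h1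

/-- An invariant divisible by X is divisible by every image cX + Y of X. These p + 1 linear forms
are pairwise coprime, and their product is f_1 up to sign. -/
theorem f1_dvd_of_psi_eq_zero {p : ℕ} [Fact p.Prime] {P : Poly p} (hP : P ∈ Inv p)
    (h : psi p P = 0) : ∃ Q ∈ Inv p, P = f1 p * Q := by
  have hX := X_dvd_of_psi_eq_zero h
  have hd : f1 p ∣ P := by
    rw [f1_eq, neg_dvd]
    apply IsRelPrime.mul_dvd
    · rw [nY_eq_prod]
      exact IsRelPrime.prod_right fun c _ => isRelPrime_vX_slant c
    · exact hX
    · rw [nY_eq_prod]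
      apply Finset.prod_dvd_of_isRelPrime
      · intro c _ d _ hcd
        exact isRelPrime_slant hcd
      · intro c _
        rw [← slant_X, ← mem_Inv_iff.1 hP (slant p c)]
        exact map_dvd _ hX
  obtain ⟨Q, rfl⟩ := hd
  refine ⟨Q, fun g => ?_, rfl⟩
  apply mul_left_cancel₀ (f1_ne_zero p)
  have h1 := mem_Inv_iff.1 hP g
  rwa [map_mul, mem_Inv_iff.1 (f1_mem p) g] at h1

theorem totalDegree_f2_le (p : ℕ) : (f2 p).totalDegree ≤ p * (p - 1) := by
  apply MvPolynomial.totalDegree_finsetSum_le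
  intro i hi
  refine (totalDegree_mul _ _).trans ?_
  refine (add_le_add (totalDegree_pow _ _) (totalDegree_pow _ _)).trans ?_
  have hi' : i ≤ p := by simpa [Nat.lt_succ_iff] using hi
  have h0 : (vX p).totalDegree ≤ 1 := (totalDegree_monomial_le _ _).trans (by simp)
  have h1 : (vY p).totalDegree ≤ 1 := (totalDegree_monomial_le _ _).trans (by simp)
  calc _ ≤ i * (p - 1) * 1 + (p - i) * (p - 1) * 1 := by gcongr
    _ = (i + (p - i)) * (p - 1) := by ring
    _ = _ := by rw [Nat.add_sub_cancel' hi']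

theorem natDegree_psi_le {p : ℕ} (P : Poly p) : (psi p P).natDegree ≤ P.totalDegree := by
  rw [psi, aeval_def, eval₂_eq']
  apply Polynomial.natDegree_sum_le_of_forall_le
  intro d hd
  have h1 : d 0 + d 1 ≤ P.totalDegree := by
    have := le_totalDegree hd
    rwa [Finsupp.sum_fintype _ _ (by simp), Fin.sum_univ_two] at this
  rw [Fin.prod_univ_two]
  refine (Polynomial.natDegree_C_mul_le _ _).trans ?_
  refine Polynomial.natDegree_mul_le.trans ?_
  have h0 : ((0 : Polynomial (ZMod p)) ^ d 0).natDegree = 0 := by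
    rw [zero_pow_eq]; split_ifs <;> simp
  have h2 := Polynomial.natDegree_X_pow_le (R := ZMod p) (d 1)
  simp only [Matrix.cons_val_zero, Matrix.cons_val_one, h0]
  omega

/-- Modulo `f_1`, an invariant is a polynomial in `f_2` of no larger degree. -/
theorem exists_psi_eq {p : ℕ} [Fact p.Prime] {P : Poly p} (hP : P ∈ Inv p) :
    ∃ Q ∈ Algebra.adjoin (ZMod p) {f1 p, f2 p}, psi p Q = psi p P ∧
      Q.totalDegree ≤ P.totalDegree := by
  refine ⟨∑ n ∈ (psi p P).support, C ((psi p P).coeff n) * f2 p ^ (n / (p * (p - 1))), ?_, ?_, ?_⟩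
  · refine sum_mem fun n _ => mul_mem ?_ (pow_mem (Algebra.subset_adjoin (by simp)) _)
    exact Subalgebra.algebraMap_mem _ _
  · nth_rw 3 [(psi p P).as_sum_support_C_mul_X_pow]
    rw [map_sum]
    refine Finset.sum_congr rfl fun n hn => ?_
    rw [map_mul, map_pow, psi_f2, ← pow_mul, Nat.mul_div_cancel'
      (dvd_of_coeff_psi_ne_zero hP (Polynomial.mem_support_iff.1 hn))]
    congr 1
    simp [psi]
  · apply MvPolynomial.totalDegree_finsetSum_le
    intro n hn
    refine (totalDegree_mul _ _).trans ?_
    rw [totalDegree_C, zero_add]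
    refine (totalDegree_pow _ _).trans ?_
    refine (Nat.mul_le_mul_left _ (totalDegree_f2_le p)).trans ?_
    rw [Nat.div_mul_cancel (dvd_of_coeff_psi_ne_zero hP (Polynomial.mem_support_iff.1 hn))]
    exact (Polynomial.le_natDegree_of_mem_supp _ hn).trans (natDegree_psi_le P)

theorem totalDegree_f1_pos (p : ℕ) [Fact p.Prime] : 0 < (f1 p).totalDegree := by
  rw [pos_iff_ne_zero]
  intro h
  rw [totalDegree_eq_zero_iff_eq_C] at h
  have h1 := congrArg (psi p) h
  rw [psi_f1] at h1
  have h2 : (f1 p).coeff 0 = 0 := by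
    simpa [psi, eq_comm (a := (0 : Polynomial (ZMod p)))] using h1
  rw [h2, C_0] at h
  exact f1_ne_zero p h

theorem adjoin_le_Inv (p : ℕ) [Fact p.Prime] :
    Algebra.adjoin (ZMod p) {f1 p, f2 p} ≤ Inv p := by
  rw [Algebra.adjoin_le_iff]
  rintro P (rfl | rfl)
  · exact f1_mem p
  · exact f2_mem p

/-- Dickson's theorem for `SL_2(F_p)`. -/
theorem Inv_eq_adjoin (p : ℕ) [Fact p.Prime] :
    Inv p = Algebra.adjoin (ZMod p) {f1 p, f2 p} := by
  refine le_antisymm (fun P hP => ?_) (adjoin_le_Inv p)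
  induction hn : P.totalDegree using Nat.strong_induction_on generalizing P with
  | _ n ih =>
    obtain ⟨Q, hQ, hQP, hdeg⟩ := exists_psi_eq hP
    obtain ⟨R, hR, hPR⟩ := f1_dvd_of_psi_eq_zero (sub_mem hP (adjoin_le_Inv p hQ))
      (by rw [map_sub, hQP, sub_self])
    have hPe : P = Q + f1 p * R := by rw [← hPR]; ring
    rw [hPe]
    refine add_mem hQ (mul_mem (Algebra.subset_adjoin (by simp)) ?_)
    by_cases hR0 : R = 0
    · rw [hR0]; exact zero_mem _
    -- The cofactor R has smaller degree, because f_1 has positive degree and Q has degree at most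
    -- that of P.
    refine ih _ ?_ _ hR rfl
    have h1 := totalDegree_mul_of_isDomain (f1_ne_zero p) hR0
    have h2 := totalDegree_sub P Q
    have h3 := totalDegree_f1_pos p
    rw [hPR, h1] at h2
    have : max P.totalDegree Q.totalDegree ≤ n := max_le hn.le (hdeg.trans hn.le)
    omega

theorem algebraicIndependent_f1_f2 (p : ℕ) [Fact p.Prime] :
    AlgebraicIndependent (ZMod p) ![f1 p, f2 p] := by
  have hp := (Fact.out : p.Prime).one_lt
  rw [algebraicIndependent_iff]
  intro F hF
  by_contra hF0
  -- Strip all powers of the first variable from a supposed relation; the remaining relation G is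
  -- not divisible by it.
  obtain ⟨n, G, hG, rfl⟩ := WfDvdMonoid.max_power_factor hF0 (X_prime (i := (0 : Fin 2))).irreducible
  rw [map_mul, map_pow, aeval_X] at hF
  have h1 : aeval ![f1 p, f2 p] G = 0 :=
    (mul_eq_zero.1 hF).resolve_left (pow_ne_zero _ (f1_ne_zero p))
  apply hG
  apply X_dvd_of_psi_eq_zero
  have hM : 0 < p * (p - 1) := Nat.mul_pos (by omega) (by omega)
  -- Restricting G(f_1, f_2) = 0 to X = 0 gives G(0, T^(p(p-1))) = 0, hence G(0, T) = 0.
  apply Polynomial.expand_injective hM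
  rw [map_zero, ← map_zero (psi p), ← h1]
  have : (Polynomial.expand (ZMod p) (p * (p - 1))).comp (psi p)
      = (psi p).comp (aeval ![f1 p, f2 p]) := by
    apply MvPolynomial.algHom_ext
    intro i
    fin_cases i
    · simp [psi_f1]
    · simp [psi_f2]
  exact DFunLike.congr_fun this G

/-! ### Congruences in the coinvariants -/

/-- Invariance under the unipotent matrix fixing `X`. -/
def UInv (p : ℕ) (c : Poly p) : Prop := subst p (unip p) c = c

theorem UInv.mul {p : ℕ} {c d : Poly p} (hc : UInv p c) (hd : UInv p d) : UInv p (c * d) := by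
  unfold UInv at *; rw [map_mul, hc, hd]

theorem UInv.pow {p : ℕ} {c : Poly p} (hc : UInv p c) (n : ℕ) : UInv p (c ^ n) := by
  unfold UInv at *; rw [map_pow, hc]

theorem UInv_one (p : ℕ) : UInv p 1 := map_one _

theorem UInv_vX (p : ℕ) : UInv p (vX p) := unip_X p

theorem UInv_natCast (p n : ℕ) : UInv p (n : Poly p) := map_natCast _ n

theorem UInv_nY (p : ℕ) [Fact p.Prime] : UInv p (nY p) := by
  have h1 : vX p ^ p = vX p ^ (p - 1) * vX p := by
    rw [← pow_succ]; congr 1; have := (Fact.out : p.Prime).pos; omega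
  rw [UInv, nY, map_sub, map_mul, map_pow, map_pow, unip_X, unip_Y, add_pow_char, h1]
  ring

theorem subst_sub_mem (p : ℕ) (g : SL2 p) (P : Poly p) : subst p g P - P ∈ ker (rho p) :=
  sub_mem_ker g P

/-- Applying the unipotent element minus 1 to cY^(b+1) gives (b+1)cXY^b plus terms of the same kind
with lower powers of Y; b + 1 is invertible modulo p. -/
theorem mul_X_mul_Y_pow_mem {p : ℕ} [Fact p.Prime] {c : Poly p} (hc : UInv p c) {b : ℕ}
    (hb : b + 1 < p) : c * vX p * vY p ^ b ∈ ker (rho p) := by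
  induction b using Nat.strong_induction_on generalizing c with
  | _ b ih =>
    have h := subst_sub_mem p (unip p) (c * vY p ^ (b + 1))
    rw [map_mul, hc, map_pow, unip_Y, add_comm (vX p), add_pow, Finset.sum_range_succ,
      Finset.sum_range_succ, mul_add, mul_add, Finset.mul_sum] at h
    have hsum : ∑ i ∈ Finset.range b, c * (vY p ^ i * vX p ^ (b + 1 - i) * ((b + 1).choose i : Poly p))
        ∈ ker (rho p) := by
      refine sum_mem fun i hi => ?_
      have hi' := Finset.mem_range.1 hi
      have := ih i hi' ((hc.mul ((UInv_vX p).pow (b - i))).mul (UInv_natCast p ((b + 1).choose i)))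
        (by omega)
      convert this using 1
      rw [show b + 1 - i = (b - i) + 1 by omega]
      ring
    have h2 := sub_mem h hsum
    have hu : ((b + 1 : ℕ) : ZMod p) ≠ 0 := by
      rw [Ne, ZMod.natCast_eq_zero_iff]
      intro hd
      have := Nat.le_of_dvd (by omega) hd
      omega
    refine ((ker (rho p)).smul_mem_iff hu).1 ?_
    convert h2 using 1
    rw [MvPolynomial.smul_eq_C_mul]
    simp
    ring

theorem mul_prod_sub_pow_mem {p : ℕ} [Fact p.Prime] {c : Poly p} (hc : UInv p c) {k j : ℕ}
    (hkj : k + j < p) :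
    c * (∏ i ∈ Finset.range k, (vY p - (i : Poly p) * vX p) - vY p ^ k) * vY p ^ j
      ∈ ker (rho p) := by
  induction k generalizing c j with
  | zero => simp
  | succ k ih =>
    rw [Finset.prod_range_succ]
    have h1 := ih hc (j := j + 1) (by omega)
    have h2 := ih ((hc.mul (UInv_vX p)).mul (UInv_natCast p k)) (j := j) (by omega)
    have h3 := mul_X_mul_Y_pow_mem (hc.mul (UInv_natCast p k)) (b := k + j) (by omega)
    convert sub_mem (sub_mem h1 h2) h3 using 1
    ring

/-- Substituting Y^p = N + X^(p-1) Y lowers r by one: the N term raises s by one, the other keeps s,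
so r + s + 1 ≤ p persists down to r = 0. -/
theorem mul_X_mul_Y_pow_mem' {p : ℕ} [Fact p.Prime] {c : Poly p} (hc : UInv p c) {r s : ℕ}
    (hs : 1 ≤ s) (hrs : r + s + 1 ≤ p) :
    c * vX p * vY p ^ ((p - 1) * (r + 1) - s) ∈ ker (rho p) := by
  induction r generalizing c s with
  | zero => exact mul_X_mul_Y_pow_mem hc (by omega)
  | succ r ih =>
    have h1 := ih (hc.mul (UInv_nY p)) (s := s + 1) (by omega) (by omega)
    have h2 := ih (hc.mul ((UInv_vX p).pow (p - 1))) hs (by omega)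
    convert add_mem h1 h2 using 1
    obtain ⟨q, rfl⟩ : ∃ q, p = q + 1 := ⟨p - 1, by omega⟩
    have e1 : (q + 1 - 1) * (r + 1 + 1) - s = (q * (r + 1) - (s + 1)) + (q + 1) := by
      have : s + 1 ≤ q * (r + 1) := by nlinarith
      simp only [Nat.add_sub_cancel, Nat.mul_add q (r + 1) 1, mul_one]
      omega
    have e2 : q * (r + 1) - s = (q * (r + 1) - (s + 1)) + 1 := by
      have : s + 1 ≤ q * (r + 1) := by nlinarith
      omega
    rw [e1]
    simp only [Nat.add_sub_cancel]
    rw [e2, nY, Nat.add_sub_cancel]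
    ring

/-- The same substitution moves a factor Y^(p-1) to X^(p-1); the N term vanishes by the previous
congruence with s = 1. -/
theorem X_pow_mul_Y_pow_sub_mem {p : ℕ} [Fact p.Prime] {c : Poly p} (hc : UInv p c) {l : ℕ}
    (hl : l + 1 ≤ p) :
    c * vX p ^ (p - 1) * vY p ^ ((p - 1) * (l + 1))
      - c * vX p ^ ((p - 1) * (l + 1)) * vY p ^ (p - 1) ∈ ker (rho p) := by
  have hp := (Fact.out : p.Prime).one_lt
  induction l generalizing c with
  | zero => simp
  | succ l ih =>
    have h1 := ih (hc.mul ((UInv_vX p).pow (p - 1))) (by omega)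
    have h2 := mul_X_mul_Y_pow_mem' ((hc.mul (UInv_nY p)).mul ((UInv_vX p).pow (p - 2)))
      (r := l) (s := 1) le_rfl (by omega)
    convert add_mem h1 h2 using 1
    obtain ⟨q, rfl⟩ : ∃ q, p = q + 2 := ⟨p - 2, by omega⟩
    obtain ⟨T, hT⟩ : ∃ T, (q + 2 - 1) * (l + 1) = T + 1 :=
      ⟨(q + 1) * (l + 1) - 1, by
        have : 1 ≤ (q + 1) * (l + 1) := Nat.mul_pos (by omega) (by omega)
        rw [show q + 2 - 1 = q + 1 by omega]
        omega⟩
    have e1 : (q + 2 - 1) * (l + 1 + 1) = T + (q + 2) := by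
      rw [Nat.mul_add, hT]; omega
    rw [e1, hT, nY, Nat.add_sub_cancel, Nat.add_sub_cancel, show q + 2 - 1 = q + 1 by omega]
    ring

/-- X^n is killed by the unipotent element, and the Weyl element identifies it with Y^n. -/
theorem Y_pow_mem {p : ℕ} [Fact p.Prime] (hp : 2 < p) {n : ℕ} (hn : 0 < n) (hev : Even n) :
    vY p ^ n ∈ ker (rho p) := by
  have h1 := mul_X_mul_Y_pow_mem ((UInv_one p).mul ((UInv_vX p).pow (n - 1))) (b := 0) (by omega)
  have h2 := subst_sub_mem p (weyl p) (vX p ^ n)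
  rw [map_pow, weyl_X] at h2
  convert add_mem h1 h2 using 1
  obtain ⟨m, rfl⟩ : ∃ m, n = m + 1 := ⟨n - 1, by omega⟩
  simp
  ring

/-- Expand N^(k-1) binomially. The pure power of Y dies and all other monomials are congruent to the
same z; since the alternating binomial coefficients sum to 0, those of the surviving terms sum to
-1. -/
theorem nY_pow_mul_Y_pow_add_mem {p : ℕ} [Fact p.Prime] (hp : 2 < p) {k : ℕ} (hk : 2 ≤ k)
    (hkp : k ≤ p) :
    nY p ^ (k - 1) * vY p ^ (p - k) + vX p ^ ((k - 1) * (p - 1)) * vY p ^ (p - 1)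
      ∈ ker (rho p) := by
  have hev : Even (p - 1) := (Fact.out : p.Prime).even_sub_one (by omega)
  obtain ⟨m, rfl⟩ : ∃ m, k = m + 1 := ⟨k - 1, by omega⟩
  rw [Nat.add_sub_cancel]
  set z := vX p ^ (m * (p - 1)) * vY p ^ (p - 1) with hz
  have hexp : nY p ^ m * vY p ^ (p - (m + 1)) = ∑ i ∈ Finset.range (m + 1),
      ((-1) ^ i * (m.choose i : Poly p)) * (vX p ^ ((p - 1) * i) * vY p ^ ((p - 1) * (m + 1 - i))) := by
    rw [nY, sub_eq_neg_add, add_pow, Finset.sum_mul]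
    refine Finset.sum_congr rfl fun i hi => ?_
    have hi' : i ≤ m := by simpa [Nat.lt_succ_iff] using hi
    obtain ⟨j, rfl⟩ : ∃ j, m = i + j := ⟨m - i, by omega⟩
    obtain ⟨q, rfl⟩ : ∃ q, p = i + j + 1 + q := ⟨p - (i + j + 1), by omega⟩
    have e : vY (i + j + 1 + q) ^ ((i + j + 1 + q - 1) * (i + j + 1 - i))
        = vY (i + j + 1 + q) ^ i * (vY (i + j + 1 + q) ^ (i + j + 1 + q)) ^ (i + j - i)
          * vY (i + j + 1 + q) ^ (i + j + 1 + q - (i + j + 1)) := by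
      rw [← pow_mul, ← pow_add, ← pow_add]
      congr 1
      rw [show i + j + 1 + q - 1 = i + j + q by omega, show i + j + 1 - i = j + 1 by omega,
        show i + j - i = j by omega, show i + j + 1 + q - (i + j + 1) = q by omega]
      ring
    rw [e, neg_pow, mul_pow, ← pow_mul]
    ring
  have hsum : ∑ i ∈ Finset.range (m + 1), ((-1) ^ i * (m.choose i : Poly p)) = 0 := by
    have := Int.alternating_sum_range_choose (n := m)
    rw [if_neg (by omega)] at this
    exact_mod_cast congrArg (Int.cast : ℤ → Poly p) this
  have hall : ∀ i ∈ Finset.range m, ((-1) ^ (i + 1) * (m.choose (i + 1) : Poly p))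
      * (vX p ^ ((p - 1) * (i + 1)) * vY p ^ ((p - 1) * (m + 1 - (i + 1))) - z) ∈ ker (rho p) := by
    intro i hi
    have hi' : i < m := Finset.mem_range.1 hi
    have hs : ((-1) ^ (i + 1) * (m.choose (i + 1) : Poly p))
        = C ((-1) ^ (i + 1) * (m.choose (i + 1) : ZMod p)) := by simp
    rw [hs, ← MvPolynomial.smul_eq_C_mul]
    apply Submodule.smul_mem
    have := X_pow_mul_Y_pow_sub_mem ((UInv_vX p).pow ((p - 1) * i)) (l := m - (i + 1)) (by omega)
    convert this using 2
    · rw [show m - (i + 1) + 1 = m + 1 - (i + 1) by omega]; ring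
    · rw [hz, ← pow_add, ← mul_add, show i + (m - (i + 1) + 1) = m by omega, mul_comm m]
  have h0 : vY p ^ ((p - 1) * (m + 1)) ∈ ker (rho p) :=
    Y_pow_mem hp (Nat.mul_pos (by omega) (by omega)) (hev.mul_right _)
  convert add_mem h0 (sum_mem hall) using 1
  rw [hexp, Finset.sum_range_succ']
  rw [Finset.sum_range_succ'] at hsum
  simp only [mul_sub, Finset.sum_sub_distrib, ← Finset.sum_mul]
  simp only [pow_zero, Nat.choose_zero_right, Nat.cast_one, mul_one, one_mul, mul_zero,
    Nat.sub_zero] at hsum ⊢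
  linear_combination z * hsum

/-- The projection to the coinvariants as a linear map over the invariants. -/
def clsHom (p : ℕ) : Poly p →ₗ[Inv p] Coinv p := (augSubmodule p).mkQ

theorem cls_eq_zero_iff {p : ℕ} {P : Poly p} : cls p P = 0 ↔ P ∈ ker (rho p) :=
  Submodule.Quotient.mk_eq_zero (augSubmodule p)

theorem cls_sub (p : ℕ) (P Q : Poly p) : cls p (P - Q) = cls p P - cls p Q :=
  map_sub (clsHom p) P Q

theorem cls_smul (p : ℕ) (a : Inv p) (P : Poly p) : cls p (a.1 * P) = a • cls p P :=
  map_smul (clsHom p) a P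

theorem cls_eq_iff {p : ℕ} {P Q : Poly p} : cls p P = cls p Q ↔ P - Q ∈ ker (rho p) := by
  rw [← cls_eq_zero_iff, cls_sub, sub_eq_zero]

theorem inv_mul_mem_ker {p : ℕ} {a P : Poly p} (ha : a ∈ Inv p) (hP : P ∈ ker (rho p)) :
    a * P ∈ ker (rho p) :=
  (augSubmodule p).smul_mem ⟨a, ha⟩ hP

theorem X_pow_mul_Y_pow_sub_eps_mem {p : ℕ} [Fact p.Prime] (n : ℕ) :
    vX p ^ n * vY p ^ (p - 1) - eps p (p - 1) (n + (p - 1)) ∈ ker (rho p) := by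
  have hp := (Fact.out : p.Prime).pos
  have h := mul_prod_sub_pow_mem ((UInv_vX p).pow n) (k := p - 1) (j := 0) (by omega)
  convert neg_mem h using 1
  rw [eps, Nat.add_sub_cancel]
  ring

/-- Replacing the monomial by -N^(k-1) Y^(p-k) turns the product into N^k X Y^(p-k), which vanishes
as p - k + 1 < p. -/
theorem f1_mul_mid_mem {p : ℕ} [Fact p.Prime] (hp : 2 < p) {k : ℕ} (hk : 2 ≤ k) (hkp : k ≤ p) :
    f1 p * (vX p ^ ((k - 1) * (p - 1)) * vY p ^ (p - 1)) ∈ ker (rho p) := by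
  have h1 := inv_mul_mem_ker (f1_mem p) (nY_pow_mul_Y_pow_add_mem hp hk hkp)
  have h2 := mul_X_mul_Y_pow_mem ((UInv_nY p).pow k) (b := p - k) (by omega)
  convert add_mem h1 h2 using 1
  obtain ⟨m, rfl⟩ : ∃ m, k = m + 1 := ⟨k - 1, by omega⟩
  rw [f1_eq, Nat.add_sub_cancel]
  ring

theorem f1_mem_ker {p : ℕ} [Fact p.Prime] : f1 p ∈ ker (rho p) := by
  have hp := (Fact.out : p.Prime).one_lt
  convert neg_mem (mul_X_mul_Y_pow_mem (UInv_nY p) (b := 0) (by omega)) using 1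
  rw [f1_eq]; ring

/-! ### Generation of the coinvariants -/

theorem span_X_nY_Y_eq_top (p : ℕ) [Fact p.Prime] :
    Submodule.span (ZMod p)
      {Q : Poly p | ∃ i j k, k < p ∧ Q = vX p ^ i * nY p ^ j * vY p ^ k} = ⊤ := by
  have hp := (Fact.out : p.Prime).one_lt
  set W := Submodule.span (ZMod p)
      {Q : Poly p | ∃ i j k, k < p ∧ Q = vX p ^ i * nY p ^ j * vY p ^ k} with hW
  have hmem : ∀ i j k, k < p → vX p ^ i * nY p ^ j * vY p ^ k ∈ W := fun i j k hk =>
    Submodule.subset_span ⟨i, j, k, hk, rfl⟩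
  refine Submodule.eq_top_iff'.2 fun P => ?_
  induction P using MvPolynomial.induction_on with
  | C a =>
    have := W.smul_mem a (hmem 0 0 0 (by omega))
    rwa [MvPolynomial.smul_eq_C_mul, pow_zero, pow_zero, pow_zero, mul_one, mul_one, mul_one] at this
  | add P Q hP hQ => exact add_mem hP hQ
  | mul_X P n hP =>
    rw [hW] at hP
    induction hP using Submodule.span_induction with
    | zero => rw [zero_mul]; exact zero_mem _
    | add P Q _ _ hP hQ => rw [add_mul]; exact add_mem hP hQ
    | smul c P _ hP => rw [smul_mul_assoc]; exact W.smul_mem c hP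
    | mem P hP =>
      obtain ⟨i, j, k, hk, rfl⟩ := hP
      fin_cases n
      · convert hmem (i + 1) j k hk using 1
        change _ * vX p = _
        ring
      · by_cases hk1 : k + 1 < p
        · convert hmem i j (k + 1) hk1 using 1
          change _ * vY p = _
          ring
        · obtain rfl : p = k + 1 := by omega
          convert add_mem (hmem i (j + 1) 0 (by omega)) (hmem (i + k) j 1 (by omega)) using 1
          change _ * vY _ = _
          rw [pow_succ (nY _) j]
          nth_rw 3 [nY]
          rw [Nat.add_sub_cancel]
          ring

/-- The polynomials whose class lies in the submodule generated by the generators. -/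
def genSubmodule (p : ℕ) : Submodule (Inv p) (Poly p) :=
  (Submodule.span (Inv p) (Set.range (gen p))).comap (clsHom p)

theorem mem_genSubmodule_iff {p : ℕ} {P : Poly p} :
    P ∈ genSubmodule p ↔ cls p P ∈ Submodule.span (Inv p) (Set.range (gen p)) := Iff.rfl

theorem ker_le_genSubmodule {p : ℕ} {P : Poly p} (h : P ∈ ker (rho p)) : P ∈ genSubmodule p := by
  rw [mem_genSubmodule_iff, cls_eq_zero_iff.2 h]
  exact zero_mem _

theorem mul_mem_genSubmodule {p : ℕ} {a P : Poly p} (ha : a ∈ Inv p) (h : P ∈ genSubmodule p) :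
    a * P ∈ genSubmodule p :=
  (genSubmodule p).smul_mem ⟨a, ha⟩ h

theorem one_mem_genSubmodule (p : ℕ) : (1 : Poly p) ∈ genSubmodule p :=
  Submodule.subset_span ⟨Sum.inr (Sum.inr ()), rfl⟩

theorem top_mem_genSubmodule (p : ℕ) : vX p ^ (p ^ 2 - p) * vY p ^ (p - 1) ∈ genSubmodule p :=
  Submodule.subset_span ⟨Sum.inl (), rfl⟩

theorem mid_mem_genSubmodule {p k : ℕ} (hk : k ∈ Finset.Icc 2 (p - 1)) :
    vX p ^ ((k - 1) * (p - 1)) * vY p ^ (p - 1) ∈ genSubmodule p :=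
  Submodule.subset_span ⟨Sum.inr (Sum.inl ⟨k, hk⟩), rfl⟩

/-- Since k + 1 < p, the term X^(p(p-1)) of f_2 contributes nothing, so f_2 acts here as N^(p-1). -/
theorem nY_pow_mul_mem_genSubmodule {p : ℕ} [Fact p.Prime] {j k : ℕ} (hk : k + 1 < p)
    (h : nY p ^ j * vY p ^ k ∈ genSubmodule p) (m : ℕ) :
    nY p ^ (m * (p - 1) + j) * vY p ^ k ∈ genSubmodule p := by
  induction m with
  | zero => simpa using h
  | succ m ih =>
    have h1 := mul_mem_genSubmodule (f2_mem p) ih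
    have h2 := ker_le_genSubmodule (mul_X_mul_Y_pow_mem
      (((UInv_nY p).pow (m * (p - 1) + j)).mul ((UInv_vX p).pow (p * (p - 1) - 1))) hk)
    convert sub_mem h1 h2 using 1
    have hM : 0 < p * (p - 1) := Nat.mul_pos (by omega) (by omega)
    have e : vX p ^ (p * (p - 1)) = vX p ^ (p * (p - 1) - 1) * vX p := by
      rw [← pow_succ]; congr 1; omega
    rw [f2_eq, e, add_mul, one_mul]
    ring

theorem nY_pow_mul_Y_pow_mem_genSubmodule {p : ℕ} [Fact p.Prime] (hp : 2 < p) {j k : ℕ}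
    (hk : k + 1 < p) (hjk : (p - 1) ∣ j + k) : nY p ^ j * vY p ^ k ∈ genSubmodule p := by
  obtain ⟨m, hm⟩ := hjk
  rcases Nat.eq_zero_or_pos k with rfl | hk0
  · have := nY_pow_mul_mem_genSubmodule (j := 0) hk (by simpa using one_mem_genSubmodule p) m
    rwa [add_zero, mul_comm m, ← hm] at this
  · obtain ⟨n, rfl⟩ : ∃ n, m = n + 1 := ⟨m - 1, by
      rcases m with _ | m
      · simp at hm; omega
      · simp⟩
    have h1 := ker_le_genSubmodule (nY_pow_mul_Y_pow_add_mem hp (k := p - k) (by omega) (by omega))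
    have h2 := sub_mem h1 (mid_mem_genSubmodule (p := p) (k := p - k)
      (Finset.mem_Icc.2 ⟨by omega, by omega⟩))
    rw [add_sub_cancel_right, show p - (p - k) = k by omega] at h2
    have := nY_pow_mul_mem_genSubmodule hk h2 n
    convert this using 3
    rw [mul_add, mul_comm] at hm
    omega

theorem X_pow_mul_Y_pow_mem_genSubmodule {p : ℕ} [Fact p.Prime] (hp : 2 < p) (m : ℕ) :
    vX p ^ (m * (p - 1)) * vY p ^ (p - 1) ∈ genSubmodule p := by
  have hev : Even (p - 1) := (Fact.out : p.Prime).even_sub_one (by omega)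
  induction m using Nat.strong_induction_on with
  | _ m ih =>
    rcases Nat.lt_or_ge p m with hm | hm
    · obtain ⟨n, rfl⟩ : ∃ n, m = n + 1 + p := ⟨m - (p + 1), by omega⟩
      -- The unwanted term N^(p-1) X^((n+1)(p-1)) Y^(p-1) of the f_2-multiple is f_1^(p-1) times the
      -- monomial of index n.
      have h1 := mul_mem_genSubmodule (f2_mem p) (ih (n + 1) (by omega))
      have h2 := mul_mem_genSubmodule (pow_mem (f1_mem p) (p - 1)) (ih n (by omega))
      convert sub_mem h1 h2 using 1
      rw [f2_eq, f1_eq, hev.neg_pow]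
      ring
    · rcases Nat.lt_or_ge m 1 with h0 | h0
      · obtain rfl : m = 0 := by omega
        rw [zero_mul, pow_zero, one_mul]
        exact ker_le_genSubmodule (Y_pow_mem hp (by omega) hev)
      rcases Nat.lt_or_ge m (p - 1) with h1 | h1
      · exact mid_mem_genSubmodule (p := p) (k := m + 1) (Finset.mem_Icc.2 ⟨by omega, by omega⟩)
      rcases h1.eq_or_lt with rfl | h2
      · have h3 := ker_le_genSubmodule (nY_pow_mul_Y_pow_add_mem hp (k := p) (by omega) le_rfl)
        have h4 := nY_pow_mul_Y_pow_mem_genSubmodule hp (j := p - 1) (k := 0) (by omega) (by simp)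
        rw [Nat.sub_self] at h3
        simpa using sub_mem h3 h4
      · obtain rfl : m = p := by omega
        convert top_mem_genSubmodule m using 3
        rw [Nat.mul_sub, mul_one, sq]

/-- Factors XN are absorbed into f_1; once X is exhausted, N^(p-1) is traded for f_2 - X^(p(p-1)).
-/
theorem X_pow_mul_nY_pow_mul_Y_pow_mem_genSubmodule {p : ℕ} [Fact p.Prime] (hp : 2 < p) {i j : ℕ}
    (hij : i ≡ j [MOD (p - 1)]) : vX p ^ i * nY p ^ j * vY p ^ (p - 1) ∈ genSubmodule p := by
  induction j using Nat.strong_induction_on generalizing i with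
  | _ j ih =>
    rcases Nat.eq_zero_or_pos j with rfl | hj
    · obtain ⟨m, rfl⟩ := (Nat.modEq_zero_iff_dvd).1 hij
      have := X_pow_mul_Y_pow_mem_genSubmodule hp m
      rw [mul_comm] at this
      simpa [mul_comm] using this
    obtain ⟨j, rfl⟩ : ∃ n, j = n + 1 := ⟨j - 1, by omega⟩
    rcases Nat.eq_zero_or_pos i with rfl | hi
    · obtain ⟨m, hm⟩ := (Nat.modEq_zero_iff_dvd).1 hij.symm
      have hle : p - 1 ≤ j + 1 := Nat.le_of_dvd (by omega) ⟨m, hm⟩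
      obtain ⟨l, hl⟩ : ∃ l, j + 1 = l + (p - 1) := ⟨j + 1 - (p - 1), by omega⟩
      have hl0 : 0 ≡ l [MOD (p - 1)] := by
        rw [hl] at hij
        simpa [Nat.ModEq] using hij
      have h1 := mul_mem_genSubmodule (f2_mem p) (ih l (by omega) hl0)
      have h2 := ih l (by omega) (i := p * (p - 1)) (by
        refine Nat.ModEq.trans ?_ hl0
        simp [Nat.ModEq])
      convert sub_mem h1 h2 using 1
      rw [f2_eq, hl]
      ring
    · obtain ⟨i, rfl⟩ : ∃ n, i = n + 1 := ⟨i - 1, by omega⟩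
      have := mul_mem_genSubmodule (f1_mem p) (ih j (by omega) (Nat.ModEq.add_right_cancel' 1 hij))
      convert neg_mem this using 1
      rw [f1_eq]
      ring

theorem torus_nY {p : ℕ} [Fact p.Prime] (u : (ZMod p)ˣ) :
    subst p (torus p u) (nY p) = C ((u⁻¹ : (ZMod p)ˣ) : ZMod p) * nY p := by
  have h : (C (u : ZMod p) : Poly p) ^ (p - 1) = 1 := by
    rw [← C_pow, ZMod.pow_card_sub_one_eq_one u.ne_zero, C_1]
  rw [nY, map_sub, map_mul, map_pow, map_pow, torus_X, torus_Y, mul_pow, mul_pow, h, ← C_pow,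
    ZMod.pow_card]
  ring

/-- The product is a torus eigenvector of weight i - j - k, which is nontrivial on a generator of
the units. -/
theorem mem_ker_of_not_modEq {p : ℕ} [Fact p.Prime] {i j k : ℕ} (h : ¬ i ≡ j + k [MOD (p - 1)]) :
    vX p ^ i * nY p ^ j * vY p ^ k ∈ ker (rho p) := by
  obtain ⟨u, hu⟩ := IsCyclic.exists_ofOrder_eq_natCard (α := (ZMod p)ˣ)
  rw [Nat.card_eq_fintype_card, ZMod.card_units] at hu
  have hne : ((u ^ i * (u⁻¹) ^ (j + k) : (ZMod p)ˣ) : ZMod p) - 1 ≠ 0 := by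
    rw [sub_ne_zero, Ne, Units.val_eq_one, inv_pow, mul_inv_eq_one, pow_eq_pow_iff_modEq, hu]
    exact h
  refine ((ker (rho p)).smul_mem_iff hne).1 ?_
  convert subst_sub_mem p (torus p u) (vX p ^ i * nY p ^ j * vY p ^ k) using 1
  rw [map_mul, map_mul, map_pow, map_pow, map_pow, torus_X, torus_Y, torus_nY,
    MvPolynomial.smul_eq_C_mul, C_sub, C_1, Units.val_mul, Units.val_pow_eq_pow_val,
    Units.val_pow_eq_pow_val, C_mul, C_pow, C_pow]
  ring

theorem genSubmodule_eq_top {p : ℕ} [Fact p.Prime] (hp : 2 < p) (P : Poly p) :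
    P ∈ genSubmodule p := by
  have hP : P ∈ (⊤ : Submodule (ZMod p) (Poly p)) := trivial
  rw [← span_X_nY_Y_eq_top] at hP
  induction hP using Submodule.span_induction with
  | zero => exact zero_mem _
  | add P Q _ _ hP hQ => exact add_mem hP hQ
  | smul c P _ hP =>
    rw [MvPolynomial.smul_eq_C_mul]
    exact mul_mem_genSubmodule ((Inv p).algebraMap_mem c) hP
  | mem P hP =>
    obtain ⟨i, j, k, hk, rfl⟩ := hP
    by_cases hmod : i ≡ j + k [MOD (p - 1)]
    · by_cases hkp : k + 1 < p
      · rcases Nat.eq_zero_or_pos i with rfl | hi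
        · rw [pow_zero, one_mul]
          exact nY_pow_mul_Y_pow_mem_genSubmodule hp hkp ((Nat.modEq_zero_iff_dvd).1 hmod.symm)
        · obtain ⟨n, rfl⟩ : ∃ n, i = n + 1 := ⟨i - 1, by omega⟩
          convert ker_le_genSubmodule (mul_X_mul_Y_pow_mem
            (((UInv_vX p).pow n).mul ((UInv_nY p).pow j)) hkp) using 1
          ring
      · obtain rfl : k = p - 1 := by omega
        exact X_pow_mul_nY_pow_mul_Y_pow_mem_genSubmodule hp (by simpa [Nat.ModEq] using hmod)
    · exact ker_le_genSubmodule (mem_ker_of_not_modEq hmod)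

/-! ### Invariant maps: line sums and transfer -/

theorem ker_le_of_subst_eq {p : ℕ} {N : Type*} [AddCommGroup N] [Module (ZMod p) N]
    (L : Poly p →ₗ[ZMod p] N) (hL : ∀ g P, L (subst p g P) = L P) {P : Poly p}
    (hP : P ∈ ker (rho p)) : L P = 0 := by
  induction hP using Submodule.span_induction with
  | zero => exact map_zero L
  | add P Q _ _ hP hQ => rw [map_add, hP, hQ, add_zero]
  | smul c P _ hP => rw [map_smul, hP, smul_zero]
  | mem P hP =>
    obtain ⟨⟨g, Q⟩, rfl⟩ := hP
    change L (subst p g Q - Q) = 0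
    rw [map_sub, hL, sub_self]

/-- Restriction of a polynomial to the line through `(x, y)`. -/
def lineEval (p : ℕ) (v : ZMod p × ZMod p) : Poly p →ₐ[ZMod p] Polynomial (ZMod p) :=
  aeval ![Polynomial.C v.1 * Polynomial.X, Polynomial.C v.2 * Polynomial.X]

@[simp] theorem lineEval_X (p : ℕ) (v : ZMod p × ZMod p) :
    lineEval p v (vX p) = Polynomial.C v.1 * Polynomial.X := by simp [lineEval]

@[simp] theorem lineEval_Y (p : ℕ) (v : ZMod p × ZMod p) :
    lineEval p v (vY p) = Polynomial.C v.2 * Polynomial.X := by simp [lineEval]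

/-- The action of a matrix on row vectors. -/
def rowEquiv (p : ℕ) (g : SL2 p) : ZMod p × ZMod p ≃ ZMod p × ZMod p where
  toFun v := (g.1 0 0 * v.1 + g.1 1 0 * v.2, g.1 0 1 * v.1 + g.1 1 1 * v.2)
  invFun v := (g.1 1 1 * v.1 - g.1 1 0 * v.2, -g.1 0 1 * v.1 + g.1 0 0 * v.2)
  left_inv v := by
    have hdet : g.1 0 0 * g.1 1 1 - g.1 0 1 * g.1 1 0 = 1 := by
      rw [← Matrix.det_fin_two]; exact g.2
    ext
    · linear_combination v.1 * hdet
    · linear_combination v.2 * hdet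
  right_inv v := by
    have hdet : g.1 0 0 * g.1 1 1 - g.1 0 1 * g.1 1 0 = 1 := by
      rw [← Matrix.det_fin_two]; exact g.2
    ext
    · linear_combination v.1 * hdet
    · linear_combination v.2 * hdet

theorem lineEval_subst (p : ℕ) (g : SL2 p) (v : ZMod p × ZMod p) (P : Poly p) :
    lineEval p v (subst p g P) = lineEval p (rowEquiv p g v) P := by
  have : (lineEval p v).comp (subst p g) = lineEval p (rowEquiv p g v) := by
    apply MvPolynomial.algHom_ext
    intro i
    have hC : ∀ c : ZMod p, lineEval p v (C c) = Polynomial.C c := fun c => by simp [lineEval]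
    fin_cases i
    · change lineEval p v (subst p g (vX p)) = lineEval p (rowEquiv p g v) (vX p)
      rw [subst_X, lineEval_X, map_add, map_mul, map_mul, hC, hC, lineEval_X, lineEval_Y]
      simp only [rowEquiv, Equiv.coe_fn_mk, Polynomial.C_add, Polynomial.C_mul]
      ring
    · change lineEval p v (subst p g (vY p)) = lineEval p (rowEquiv p g v) (vY p)
      rw [subst_Y, lineEval_Y, map_add, map_mul, map_mul, hC, hC, lineEval_X, lineEval_Y]
      simp only [rowEquiv, Equiv.coe_fn_mk, Polynomial.C_add, Polynomial.C_mul]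
      ring
  exact DFunLike.congr_fun this P

/-- The sum of the restrictions of a polynomial to the lines through the nonzero points of
the plane. -/
def lineSum (p : ℕ) [Fact p.Prime] : Poly p →ₗ[ZMod p] Polynomial (ZMod p) :=
  ∑ v : ZMod p × ZMod p, (lineEval p v).toLinearMap - (lineEval p 0).toLinearMap

theorem lineSum_apply (p : ℕ) [Fact p.Prime] (P : Poly p) :
    lineSum p P = ∑ v : ZMod p × ZMod p, lineEval p v P - lineEval p 0 P := by
  simp [lineSum, LinearMap.sum_apply]

theorem lineSum_eq_zero {p : ℕ} [Fact p.Prime] {P : Poly p} (hP : P ∈ ker (rho p)) :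
    lineSum p P = 0 := by
  refine ker_le_of_subst_eq _ (fun g P => ?_) hP
  simp only [lineSum_apply, lineEval_subst]
  congr 1
  · exact Equiv.sum_comp (rowEquiv p g) fun v => lineEval p v P
  · rw [show rowEquiv p g 0 = 0 by simp [rowEquiv]]

/-- On a line through a nonzero point an invariant is the same as on the line `X = 0`. -/
theorem lineEval_eq_psi {p : ℕ} [Fact p.Prime] {P : Poly p} (hP : P ∈ Inv p)
    {v : ZMod p × ZMod p} (hv : v ≠ 0) : lineEval p v P = psi p P := by
  have h0 : psi p = lineEval p (0, 1) := by
    apply MvPolynomial.algHom_ext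
    intro i
    fin_cases i <;> simp [psi, lineEval]
  obtain ⟨g, hg⟩ : ∃ g : SL2 p, rowEquiv p g (0, 1) = v := by
    obtain ⟨x, y⟩ := v
    by_cases hx : x = 0
    · have hy : y ≠ 0 := fun hy => hv (by rw [hx, hy]; rfl)
      exact ⟨⟨!![y⁻¹, 0; 0, y], by simp [hy]⟩, by simp [rowEquiv, hx]⟩
    · exact ⟨⟨!![0, -x⁻¹; x, y], by simp [hx]⟩, by simp [rowEquiv]⟩
  rw [h0, ← hg, ← lineEval_subst, mem_Inv_iff.1 hP]

/-- All nonzero points lie in one orbit, so `a` restricts alike to every line in the sum; this is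
why the origin is left out. -/
theorem lineSum_mul {p : ℕ} [Fact p.Prime] {a : Poly p} (ha : a ∈ Inv p) (P : Poly p) :
    lineSum p (a * P) = psi p a * lineSum p P := by
  classical
  simp only [lineSum_apply, ← Finset.add_sum_erase _ _ (Finset.mem_univ (0 : ZMod p × ZMod p)),
    add_sub_cancel_left, Finset.mul_sum]
  refine Finset.sum_congr rfl fun v hv => ?_
  rw [map_mul, lineEval_eq_psi ha (Finset.ne_of_mem_erase hv)]

theorem sum_pow_mul_sub_one {p : ℕ} [Fact p.Prime] {n : ℕ} (hn : 0 < n) :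
    ∑ x : ZMod p, x ^ (n * (p - 1)) = -1 := by
  have hp := (Fact.out : p.Prime).one_lt
  have h : ∀ x : ZMod p, x ^ (n * (p - 1)) = 1 - if x = 0 then 1 else 0 := by
    intro x
    split_ifs with hx
    · rw [hx, zero_pow (Nat.mul_pos hn (by omega)).ne', sub_self]
    · rw [mul_comm, pow_mul, ZMod.pow_card_sub_one_eq_one hx, one_pow, sub_zero]
  simp [h, ZMod.card]

theorem lineSum_one (p : ℕ) [Fact p.Prime] : lineSum p 1 = -1 := by
  simp [lineSum_apply, ZMod.card]

theorem lineSum_mid {p : ℕ} [Fact p.Prime] {k : ℕ} (hk : 2 ≤ k) :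
    lineSum p (vX p ^ ((k - 1) * (p - 1)) * vY p ^ (p - 1)) = Polynomial.X ^ (k * (p - 1)) := by
  have hp := (Fact.out : p.Prime).one_lt
  obtain ⟨m, rfl⟩ : ∃ m, k = m + 1 := ⟨k - 1, by omega⟩
  rw [lineSum_apply, Nat.add_sub_cancel]
  have h : ∀ v : ZMod p × ZMod p, lineEval p v (vX p ^ (m * (p - 1)) * vY p ^ (p - 1))
      = Polynomial.C (v.1 ^ (m * (p - 1)) * v.2 ^ (1 * (p - 1))) * Polynomial.X ^ ((m + 1) * (p - 1)) := by
    intro v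
    rw [map_mul, map_pow, map_pow, lineEval_X, lineEval_Y, Polynomial.C_mul, Polynomial.C_pow,
      Polynomial.C_pow]
    ring
  have h0 : p - 1 ≠ 0 := by omega
  simp only [h, ← Finset.sum_mul, ← map_sum, Fintype.sum_prod_type, ← Finset.mul_sum]
  rw [sum_pow_mul_sub_one one_pos, sum_pow_mul_sub_one (by omega)]
  simp [h0]

/-- The transfer from polynomials to invariants. -/
def transfer (p : ℕ) [Fact p.Prime] : Poly p →ₗ[ZMod p] Poly p :=
  ∑ g : SL2 p, (subst p g).toLinearMap

theorem transfer_apply (p : ℕ) [Fact p.Prime] (P : Poly p) :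
    transfer p P = ∑ g : SL2 p, subst p g P := by
  simp [transfer, LinearMap.sum_apply]

theorem transfer_eq_zero {p : ℕ} [Fact p.Prime] {P : Poly p} (hP : P ∈ ker (rho p)) :
    transfer p P = 0 := by
  refine ker_le_of_subst_eq _ (fun g P => ?_) hP
  simp only [transfer_apply]
  refine Fintype.sum_equiv (Equiv.mulRight g) _ _ fun h => ?_
  rw [Equiv.coe_mulRight, subst_mul, AlgHom.comp_apply]

theorem transfer_mul {p : ℕ} [Fact p.Prime] {a : Poly p} (ha : a ∈ Inv p) (P : Poly p) :
    transfer p (a * P) = a * transfer p P := by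
  simp only [transfer_apply, Finset.mul_sum, map_mul, mem_Inv_iff.1 ha]

/-- Parametrization of the matrices with nonzero upper left entry. -/
def bigCell (p : ℕ) (t : (ZMod p)ˣ × ZMod p × ZMod p) : SL2 p :=
  ⟨!![(t.1 : ZMod p), t.2.1; t.2.2, (t.1⁻¹ : (ZMod p)ˣ) * (1 + t.2.1 * t.2.2)], by
    rw [Matrix.det_fin_two_of, ← mul_assoc, Units.mul_inv]; ring⟩

theorem bigCell_injective (p : ℕ) : Function.Injective (bigCell p) := by
  rintro ⟨u, b, c⟩ ⟨u', b', c'⟩ h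
  have h1 := congrArg (fun g : SL2 p => g.1) h
  have h00 : (u : ZMod p) = u' := congrFun (congrFun h1 0) 0
  have h01 : b = b' := congrFun (congrFun h1 0) 1
  have h10 : c = c' := congrFun (congrFun h1 1) 0
  rw [h01, h10, Units.ext h00]

theorem mem_range_bigCell {p : ℕ} [Fact p.Prime] {g : SL2 p} (ha : g.1 0 0 ≠ 0) :
    g ∈ Set.range (bigCell p) := by
  have hdet : g.1 0 0 * g.1 1 1 - g.1 0 1 * g.1 1 0 = 1 := by
    rw [← Matrix.det_fin_two]; exact g.2
  refine ⟨(Units.mk0 _ ha, g.1 0 1, g.1 1 0), ?_⟩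
  ext i j
  fin_cases i <;> fin_cases j
  · rfl
  · rfl
  · rfl
  · change ((Units.mk0 _ ha)⁻¹ : (ZMod p)ˣ) * (1 + g.1 0 1 * g.1 1 0) = g.1 1 1
    rw [Units.val_inv_eq_inv_val, Units.val_mk0, inv_mul_eq_iff_eq_mul₀ ha]
    linear_combination -hdet

/-- Only matrices with a ≠ 0 matter, and there ad = 1 + bc. Summing (1 + bc)^(p-1) over c gives
-b^(p-1), then 1 over b, then p - 1 = -1 over the units a. -/
theorem sum_SL2_diag_pow (p : ℕ) [Fact p.Prime] :
    ∑ g : SL2 p, g.1 0 0 ^ (p - 1) * g.1 1 1 ^ (p - 1) = -1 := by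
  have hp := (Fact.out : p.Prime).one_lt
  have h0 : p - 1 ≠ 0 := by omega
  rw [← Fintype.sum_of_injective (bigCell p) (bigCell_injective p)
    (fun t => (1 + t.2.1 * t.2.2) ^ (p - 1)) _]
  · have hb : ∀ b : ZMod p, ∑ c : ZMod p, (1 + b * c) ^ (p - 1) = -b ^ (1 * (p - 1)) := by
      intro b
      by_cases hb : b = 0
      · simp [hb, ZMod.card, h0]
      · rw [one_mul, ZMod.pow_card_sub_one_eq_one hb, ← sum_pow_mul_sub_one (p := p) one_pos,
          one_mul]
        exact Fintype.sum_equiv ((Equiv.mulLeft₀ b hb).trans (Equiv.addLeft 1)) _ _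
          fun c => by simp
    simp only [Fintype.sum_prod_type, hb, Finset.sum_neg_distrib, sum_pow_mul_sub_one one_pos]
    rw [neg_neg, Finset.sum_const, Finset.card_univ, ZMod.card_units, nsmul_one,
      Nat.cast_sub hp.le, CharP.cast_eq_zero, Nat.cast_one, zero_sub]
  · intro g hg
    by_cases ha : g.1 0 0 = 0
    · rw [ha, zero_pow h0, zero_mul]
    · exact absurd (mem_range_bigCell ha) hg
  · rintro ⟨u, b, c⟩
    change _ = (u : ZMod p) ^ (p - 1) * (((u⁻¹ : (ZMod p)ˣ) : ZMod p) * (1 + b * c)) ^ (p - 1)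
    rw [← mul_pow, ← mul_assoc, Units.mul_inv, one_mul]

/-- At X = 1 Frobenius gives (a + cY^p)^(p-1) (b + dY)^(p-1), and below degree p the first factor is
just a^(p-1). -/
theorem coeff_subst_top {p : ℕ} [Fact p.Prime] (g : SL2 p) :
    (aeval ![1, Polynomial.X] (subst p g (vX p ^ (p ^ 2 - p) * vY p ^ (p - 1))) :
      Polynomial (ZMod p)).coeff (p - 1) = g.1 0 0 ^ (p - 1) * g.1 1 1 ^ (p - 1) := by
  have hp := (Fact.out : p.Prime).one_lt
  have e : p ^ 2 - p = p * (p - 1) := by rw [Nat.mul_sub, mul_one, sq]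
  have h1 : (aeval ![1, Polynomial.X] (subst p g (vX p ^ (p ^ 2 - p) * vY p ^ (p - 1))) :
      Polynomial (ZMod p)) = (Polynomial.C (g.1 0 0) + Polynomial.C (g.1 1 0) * Polynomial.X ^ p) ^ (p - 1)
        * (Polynomial.C (g.1 0 1) + Polynomial.C (g.1 1 1) * Polynomial.X) ^ (p - 1) := by
    rw [map_mul, map_pow, map_pow, subst_X, subst_Y, e, pow_mul, add_pow_char, mul_pow, mul_pow,
      ← C_pow, ← C_pow, ZMod.pow_card, ZMod.pow_card]
    simp
  obtain ⟨R, hR⟩ : Polynomial.X ^ p ∣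
      (Polynomial.C (g.1 0 0) + Polynomial.C (g.1 1 0) * Polynomial.X ^ p) ^ (p - 1)
        - Polynomial.C (g.1 0 0) ^ (p - 1) := by
    refine dvd_trans ?_ (sub_dvd_pow_sub_pow _ _ _)
    rw [add_sub_cancel_left]
    exact Dvd.intro_left _ rfl
  have hdeg : (Polynomial.C (g.1 0 1) + Polynomial.C (g.1 1 1) * Polynomial.X).natDegree ≤ 1 := by
    rw [add_comm]; exact Polynomial.natDegree_linear_le
  have hc := Polynomial.coeff_pow_of_natDegree_le (m := p - 1) hdeg
  rw [h1, sub_eq_iff_eq_add.1 hR, add_mul, Polynomial.coeff_add, mul_assoc,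
    Polynomial.coeff_X_pow_mul', if_neg (by omega), zero_add, ← Polynomial.C_pow,
    Polynomial.coeff_C_mul]
  rw [mul_one] at hc
  rw [hc]
  simp

theorem transfer_top_ne_zero (p : ℕ) [Fact p.Prime] :
    transfer p (vX p ^ (p ^ 2 - p) * vY p ^ (p - 1)) ≠ 0 := by
  intro h
  have h2 := congrArg (fun P => (aeval ![1, Polynomial.X] P : Polynomial (ZMod p)).coeff (p - 1)) h
  simp only [transfer_apply, map_sum, Polynomial.finsetSum_coeff, coeff_subst_top,
    sum_SL2_diag_pow, map_zero, Polynomial.coeff_zero] at h2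
  simp at h2

/-! ### Annihilators and independence of the generators -/

/-- The monomials representing the generators. -/
def genPoly (p : ℕ) : Idx p → Poly p :=
  Sum.elim (fun _ => vX p ^ (p ^ 2 - p) * vY p ^ (p - 1))
    (Sum.elim (fun k => vX p ^ ((k.1 - 1) * (p - 1)) * vY p ^ (p - 1)) (fun _ => 1))

theorem gen_eq_cls (p : ℕ) (i : Idx p) : gen p i = cls p (genPoly p i) := by
  rcases i with _ | _ | _ <;> rfl

/-- The degrees of the torsion generators, divided by `p - 1`. -/
def torDeg (p : ℕ) : {k : ℕ // k ∈ Finset.Icc 2 (p - 1)} ⊕ Unit → ℕ :=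
  Sum.elim (fun k => k.1) (fun _ => 0)

theorem torDeg_injective (p : ℕ) : Function.Injective (torDeg p) := by
  rintro (k | _) (l | _) h
  · exact congrArg _ (Subtype.ext h)
  · have := (Finset.mem_Icc.1 k.2).1
    change k.1 = 0 at h
    omega
  · have := (Finset.mem_Icc.1 l.2).1
    change 0 = l.1 at h
    omega
  · rfl

theorem torDeg_lt {p : ℕ} (hp : 0 < p) (i) : torDeg p i < p := by
  rcases i with k | _
  · have := (Finset.mem_Icc.1 k.2).2
    change k.1 < p
    omega
  · exact hp

theorem exists_lineSum_genPoly {p : ℕ} [Fact p.Prime] (i) :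
    ∃ u : ZMod p, u ≠ 0 ∧ lineSum p (genPoly p (Sum.inr i))
      = Polynomial.C u * Polynomial.X ^ (torDeg p i * (p - 1)) := by
  rcases i with k | _
  · refine ⟨1, one_ne_zero, ?_⟩
    rw [Polynomial.C_1, one_mul]
    exact lineSum_mid (Finset.mem_Icc.1 k.2).1
  · refine ⟨-1, neg_ne_zero.2 one_ne_zero, ?_⟩
    rw [torDeg, Sum.elim_inr, zero_mul, pow_zero, mul_one, Polynomial.C_neg, Polynomial.C_1]
    exact lineSum_one p

theorem f1_mul_genPoly_mem {p : ℕ} [Fact p.Prime] (hp : 2 < p) (i) :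
    f1 p * genPoly p (Sum.inr i) ∈ ker (rho p) := by
  rcases i with ⟨k, hk⟩ | _
  · have := Finset.mem_Icc.1 hk
    have hkp : k ≤ p := by omega
    exact f1_mul_mid_mem hp this.1 hkp
  · change f1 p * 1 ∈ _
    rw [mul_one]
    exact f1_mem_ker

theorem smul_gen_eq_zero_of_psi {p : ℕ} [Fact p.Prime] (hp : 2 < p) (i) {a : Inv p}
    (ha : psi p a.1 = 0) : a • gen p (Sum.inr i) = 0 := by
  obtain ⟨Q, hQ, h⟩ := f1_dvd_of_psi_eq_zero a.2 ha
  rw [gen_eq_cls, ← cls_smul, cls_eq_zero_iff, h, mul_comm (f1 p), mul_assoc]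
  exact inv_mul_mem_ker hQ (f1_mul_genPoly_mem hp i)

theorem smul_gen_inr_eq_zero_iff {p : ℕ} [Fact p.Prime] (hp : 2 < p) (i) (a : Inv p) :
    a • gen p (Sum.inr i) = 0 ↔ a ∈ Ideal.span {f1Inv p} := by
  constructor
  · intro h
    rw [gen_eq_cls, ← cls_smul, cls_eq_zero_iff] at h
    have h1 := lineSum_eq_zero h
    obtain ⟨u, hu, hi⟩ := exists_lineSum_genPoly (p := p) i
    rw [lineSum_mul a.2, hi] at h1
    have h2 : psi p a.1 = 0 := (mul_eq_zero.1 h1).resolve_right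
      (mul_ne_zero (Polynomial.C_ne_zero.2 hu) (pow_ne_zero _ Polynomial.X_ne_zero))
    obtain ⟨Q, hQ, h3⟩ := f1_dvd_of_psi_eq_zero a.2 h2
    exact Ideal.mem_span_singleton.2 ⟨⟨Q, hQ⟩, Subtype.ext h3⟩
  · intro h
    obtain ⟨b, rfl⟩ := Ideal.mem_span_singleton.1 h
    apply smul_gen_eq_zero_of_psi hp
    change psi p (f1 p * b.1) = 0
    rw [map_mul, psi_f1, zero_mul]

theorem smul_topGen_eq_zero_iff {p : ℕ} [Fact p.Prime] (a : Inv p) :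
    a • topGen p = 0 ↔ a = 0 := by
  refine ⟨fun h => ?_, fun h => by rw [h, zero_smul]⟩
  rw [topGen, ← cls_smul, cls_eq_zero_iff] at h
  have h1 := transfer_eq_zero h
  rw [transfer_mul a.2] at h1
  exact Subtype.ext ((mul_eq_zero.1 h1).resolve_right (transfer_top_ne_zero p))

/-- The transfer is A-linear into a domain, so it vanishes on f_1-torsion. -/
theorem transfer_genPoly_inr {p : ℕ} [Fact p.Prime] (hp : 2 < p) (i) :
    transfer p (genPoly p (Sum.inr i)) = 0 := by
  have h := transfer_eq_zero (f1_mul_genPoly_mem hp i)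
  rw [transfer_mul (f1_mem p)] at h
  exact (mul_eq_zero.1 h).resolve_left (f1_ne_zero p)

/-- After division by p - 1, the exponents that occur are all congruent to e modulo p, while the one
tested is congruent to d. -/
theorem coeff_psi_mul_eq_zero {p : ℕ} [Fact p.Prime] {P : Poly p} (hP : P ∈ Inv p) (u : ZMod p)
    {d e m : ℕ} (hd : d < p) (he : e < p) (hde : d ≠ e) :
    (psi p P * (Polynomial.C u * Polynomial.X ^ (e * (p - 1)))).coeff
      (p * (p - 1) * m + d * (p - 1)) = 0 := by
  have hp := (Fact.out : p.Prime).one_lt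
  rw [← mul_assoc, Polynomial.coeff_mul_X_pow']
  split_ifs with hle
  · rw [Polynomial.coeff_mul_C]
    by_contra h
    obtain ⟨n, hn⟩ := dvd_of_coeff_psi_ne_zero hP (left_ne_zero_of_mul h)
    have h1 : p * (p - 1) * m + d * (p - 1) = p * (p - 1) * n + e * (p - 1) := by omega
    have h2 : (p * m + d) * (p - 1) = (p * n + e) * (p - 1) := by linarith
    have h3 : p * m + d = p * n + e := Nat.eq_of_mul_eq_mul_right (by omega) h2
    have h4 := congrArg (· % p) h3
    simp only [Nat.mul_add_mod, Nat.mod_eq_of_lt hd, Nat.mod_eq_of_lt he] at h4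
    exact hde h4
  · rfl

/-- The transfer isolates the coefficient of the top generator. With that gone, `lineSum` separates
the torsion generators by exponents modulo p(p-1). -/
theorem smul_gen_eq_zero_of_sum_eq_zero {p : ℕ} [Fact p.Prime] (hp : 2 < p) (s : Finset (Idx p))
    (a : Idx p → Inv p) (h : ∑ i ∈ s, a i • gen p i = 0) : ∀ i ∈ s, a i • gen p i = 0 := by
  have hsum : ∑ i ∈ s, (a i).1 * genPoly p i ∈ ker (rho p) := by
    rw [← cls_eq_zero_iff, ← h]
    refine (map_sum (clsHom p) _ _).trans (Finset.sum_congr rfl fun i _ => ?_)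
    rw [gen_eq_cls]
    exact cls_smul p (a i) _
  have htop : ∀ t, Sum.inl t ∈ s → a (Sum.inl t) = 0 := by
    intro t ht
    have h1 := transfer_eq_zero hsum
    rw [map_sum, Finset.sum_eq_single_of_mem _ ht, transfer_mul (a _).2] at h1
    · exact Subtype.ext ((mul_eq_zero.1 h1).resolve_right (transfer_top_ne_zero p))
    · rintro (t' | i) _ hne
      · exact absurd rfl hne
      · rw [transfer_mul (a _).2, transfer_genPoly_inr hp, mul_zero]
  rintro (t | i) hi
  · rw [htop t hi, zero_smul]
  apply smul_gen_eq_zero_of_psi hp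
  by_contra hne
  obtain ⟨n, hn⟩ : ∃ n, (psi p (a (Sum.inr i)).1).coeff n ≠ 0 := by
    by_contra! hall
    exact hne (Polynomial.ext fun n => by rw [hall n, Polynomial.coeff_zero])
  obtain ⟨m, rfl⟩ := dvd_of_coeff_psi_ne_zero (a _).2 hn
  have h1 := lineSum_eq_zero hsum
  replace h1 := congrArg
    (fun Q => Polynomial.coeff Q (p * (p - 1) * m + torDeg p i * (p - 1))) h1
  simp only [map_sum, Polynomial.finsetSum_coeff, Polynomial.coeff_zero] at h1
  rw [Finset.sum_eq_single_of_mem _ hi, lineSum_mul (a _).2] at h1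
  · obtain ⟨u, hu, hu'⟩ := exists_lineSum_genPoly (p := p) i
    rw [hu', ← mul_assoc, Polynomial.coeff_mul_X_pow, Polynomial.coeff_mul_C] at h1
    exact mul_ne_zero hn hu h1
  · rintro (t | j) hj hne
    · rw [htop t hj]
      simp
    · obtain ⟨u, -, hu'⟩ := exists_lineSum_genPoly (p := p) j
      rw [lineSum_mul (a _).2, hu']
      exact coeff_psi_mul_eq_zero (a _).2 u (torDeg_lt (by omega) i) (torDeg_lt (by omega) j)
        fun he => hne (by rw [torDeg_injective p he])

theorem isInternal_span_gen {p : ℕ} [Fact p.Prime] (hp : 2 < p) :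
    DirectSum.IsInternal (fun i : Idx p => Submodule.span (Inv p) {gen p i}) := by
  rw [DirectSum.isInternal_submodule_iff_iSupIndep_and_iSup_eq_top]
  constructor
  · rw [iSupIndep_iff_finsetSum_eq_zero_imp_eq_zero]
    intro s v hv hsum
    have hex : ∀ i, ∃ a : Inv p, i ∈ s → a • gen p i = v i := by
      intro i
      by_cases hi : i ∈ s
      · obtain ⟨a, ha⟩ := Submodule.mem_span_singleton.1 (hv i hi)
        exact ⟨a, fun _ => ha⟩
      · exact ⟨0, fun h => absurd h hi⟩
    choose a ha using hex
    intro i hi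
    rw [← ha i hi]
    refine smul_gen_eq_zero_of_sum_eq_zero hp s a ?_ i hi
    rw [← hsum]
    exact Finset.sum_congr rfl ha
  · rw [← Submodule.span_range_eq_iSup, Submodule.eq_top_iff']
    intro x
    obtain ⟨P, rfl⟩ := Submodule.Quotient.mk_surjective (augSubmodule p) x
    exact genSubmodule_eq_top hp P

theorem exists_quotient_equiv_span_singleton {R M : Type*} [CommRing R] [AddCommGroup M]
    [Module R M] (I : Ideal R) (x : M) (h : ∀ a : R, a • x = 0 ↔ a ∈ I) :
    ∃ e : (R ⧸ I) ≃ₗ[R] Submodule.span R {x}, (e 1 : M) = x := by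
  have hI : I = LinearMap.ker (LinearMap.toSpanSingleton R M x) := by
    ext a
    rw [LinearMap.mem_ker, LinearMap.toSpanSingleton_apply, h]
  refine ⟨(Submodule.quotEquivOfEq _ _ hI).trans
    ((LinearMap.quotKerEquivRange _).trans
      (LinearEquiv.ofEq _ _ (LinearMap.span_singleton_eq_range R M x).symm)), ?_⟩
  change (1 : R) • x = x
  exact one_smul R x

theorem exists_equiv_span_singleton {R M : Type*} [CommRing R] [AddCommGroup M]
    [Module R M] (x : M) (h : ∀ a : R, a • x = 0 ↔ a = 0) :
    ∃ e : R ≃ₗ[R] Submodule.span R {x}, (e 1 : M) = x := by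
  have hinj : Function.Injective (LinearMap.toSpanSingleton R M x) := by
    rw [← LinearMap.ker_eq_bot, LinearMap.ker_eq_bot']
    exact fun a ha => (h a).1 ha
  refine ⟨(LinearEquiv.ofInjective _ hinj).trans
      (LinearEquiv.ofEq _ _ (LinearMap.span_singleton_eq_range R M x).symm), ?_⟩
  change (1 : R) • x = x
  exact one_smul R x

end

end ModPCoinvariants

open ModPCoinvariants in
theorem mainTheorem2 (p : ℕ) [Fact p.Prime] (hp : 3 < p) :
    -- the ring of invariants is the polynomial ring on `f_1` and `f_2`
    (Inv p = Algebra.adjoin (ZMod p) {f1 p, f2 p} ∧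
      AlgebraicIndependent (ZMod p) ![f1 p, f2 p]) ∧
    -- the coinvariants are the internal direct sum of the cyclic submodules on the generators
    DirectSum.IsInternal (fun i : Idx p => Submodule.span (Inv p) {gen p i}) ∧
    -- the first summand is free of rank one over the invariants
    (∃ e : Inv p ≃ₗ[Inv p] Submodule.span (Inv p) {topGen p}, (e (1 : Inv p) : Coinv p) = topGen p) ∧
    -- the other summands are free of rank one over the invariants modulo `f_1`
    (∀ k ∈ Finset.Icc 2 (p - 1),
      ∃ e : InvModF1 p ≃ₗ[Inv p] Submodule.span (Inv p) {midGen p k},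
        (e (1 : InvModF1 p) : Coinv p) = midGen p k) ∧
    (∃ e : InvModF1 p ≃ₗ[Inv p] Submodule.span (Inv p) {oneGen p},
      (e (1 : InvModF1 p) : Coinv p) = oneGen p) ∧
    -- the generators are also the classes of the forms `ε_{p-1}^n`
    topGen p = cls p (eps p (p - 1) (p ^ 2 - 1)) ∧
    (∀ k ∈ Finset.Icc 2 (p - 1), midGen p k = cls p (eps p (p - 1) (k * (p - 1)))) := by
  have hp2 : 2 < p := by omega
  refine ⟨⟨Inv_eq_adjoin p, algebraicIndependent_f1_f2 p⟩, isInternal_span_gen hp2,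
    exists_equiv_span_singleton _ smul_topGen_eq_zero_iff, fun k hk => ?_, ?_, ?_, fun k hk => ?_⟩
  · exact exists_quotient_equiv_span_singleton _ _
      (smul_gen_inr_eq_zero_iff hp2 (Sum.inl ⟨k, hk⟩))
  · exact exists_quotient_equiv_span_singleton _ _ (smul_gen_inr_eq_zero_iff hp2 (Sum.inr ()))
  · have h := X_pow_mul_Y_pow_sub_eps_mem (p := p) (p ^ 2 - p)
    have hsq : p ≤ p ^ 2 := by nlinarith
    rw [show p ^ 2 - p + (p - 1) = p ^ 2 - 1 by omega] at h
    exact cls_eq_iff.2 h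
  · have h := X_pow_mul_Y_pow_sub_eps_mem (p := p) ((k - 1) * (p - 1))
    obtain ⟨m, rfl⟩ : ∃ m, k = m + 1 := ⟨k - 1, by have := (Finset.mem_Icc.1 hk).1; omega⟩
    rw [Nat.add_sub_cancel, ← Nat.succ_mul] at h
    exact cls_eq_iff.2 h
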